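/- **Time-averaged entropy loss principle.** Let $d\in\{1,2\}$, $q\in\mathbb N$, and let $\Omega=\{1,\dots,q\}^{\mathbb Z^d}$ carry the product topology and its Borel $\sigma$-algebra. For $x\in\mathbb Z^d$ and a state $j$ let $c_x(\cdot,j):\Omega\to[0,\infty)$ be the rate at which the state at $x$ is replaced by $j$. For $f:\Omega\to\mathbb R$ let $\delta_y f=\sup\{|f(\eta)-f(\xi)|:\eta_z=\xi_z\ \text{for all } z\neq y\}$ and let $D(\Omega)$ be the set of continuous $f$ with $\sum_x\delta_xf<\infty$. Assume: * (R1) $\sup_{x}\sum_{j}\|c_x(\cdot,j)\|_\infty<\infty$; * (R2) each $c_x(\cdot,j)$ is continuous; * (R3) $\inf_{x,\eta,j}c_x(\eta,j)>0$; * (R4) $\sum_{y\in\mathbb Z^d}|y|\,\sup_{x\in\mathbb Z^d}\sum_{j}\delta_{x+y}\big(\tilde c_x(\cdot,j)\big)<\infty$, where $\tilde c_x(\eta,j)=c_x(\eta,j)\mathbf 1_{\{\eta_x\ne j\}}$ is the rate of an actual change at $x$ to the state $j$. Let $(P_t)_{t\ge0}$ be the Markov semigroup on $C(\Omega)$ whose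 generator is given on its core $D(\Omega)$ by $\mathscr Lf(\eta)=\sum_{x}\sum_{j}c_x(\eta,j)\,[f(\eta^{x,j})-f(\eta)]$, where $\eta^{x,j}$ equals $\eta$ except for the state $j$ at $x$. For a finite $\Lambda\subset\mathbb Z^d$ and probability measures $\nu,\mu$ on $\Omega$ write $\nu(\omega_\Lambda)$ for the $\nu$-mass of the cylinder set $\{\eta:\eta_\Lambda=\omega_\Lambda\}$, let $h_\Lambda(\nu|\mu)=\sum_{\omega_\Lambda}\nu(\omega_\Lambda)\log\frac{\nu(\omega_\Lambda)}{\mu(\omega_\Lambda)}$ (with $0\log0=0$) if the marginals on $\Lambda$ satisfy $\nu_\Lambda\ll\mu_\Lambda$ and $h_\Lambda(\nu|\mu)=\infty$ otherwise, and let $g_\Lambda(\nu|\mu)=\frac{d}{dt}\big|_{t=0}h_\Lambda(\nu P_t|\mu)$ (right derivative). Let $\mu$ be a product probability measure on $\Omega$ (the one-site marginals may depend on the site) with $\mu P_t=\mu$ for all $t\ge0$. Let $\nu$ be a probability measure on $\Omega$ and $T>0$ such that * (M1) $\nu P_s(\omega_\Lambda)>0$ for all finite $\Lambda\subset\mathbb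 Z^d$, all $\omega_\Lambda\in\{1,\dots,q\}^\Lambda$ and all $s\ge0$; * (M2) $\int_0^Tg_\Lambda(\nu P_s|\mu)\,ds=0$ for all finite $\Lambda\subset\mathbb Z^d$. Then $\nu=\mu$. -/

import Mathlib

open MeasureTheory ProbabilityTheory Filter Topology
open scoped NNReal ENNReal

noncomputable section

namespace IPS

/-- The sites of the lattice `ℤ^d`; the norm on this type is the maximum norm. -/
abbrev Site (d : ℕ) : Type := Fin d → ℤ

/-- Configurations: `q` possible states at each site of `ℤ^d`. Topology and sigma-algebra are
the product ones. -/
abbrev Config (d q : ℕ) : Type := Site d → Fin q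

/-- Single-site transition rates: `c x η j` is the rate at which the state at `x` is replaced
by `j` when the whole system is in the configuration `η`. -/
abbrev Rates (d q : ℕ) : Type := Site d → Config d q → Fin q → ℝ

variable {d q : ℕ}

/-- The oscillation `δ_y f` of `f` at the site `y`. -/
def osc (y : Site d) (f : Config d q → ℝ) : ℝ≥0∞ :=
  ⨆ (η : Config d q) (ξ : Config d q) (_ : ∀ z, z ≠ y → η z = ξ z), ‖f η - f ξ‖ₑ

/-- The function `η ↦ c_x(η, j) 1_{η_x ≠ j}`: the rate of an actual change of the state at `x`
to `j`. -/
def jumpRate (c : Rates d q) (x : Site d) (j : Fin q) (η : Config d q) : ℝ :=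
  if η x = j then 0 else c x η j

/-- The conditions on the rates. -/
structure RateConditions (c : Rates d q) : Prop where
  /-- The rates are uniformly bounded. -/
  bounded : (⨆ x, ∑ j, ⨆ η, ‖c x η j‖ₑ) < ∞
  /-- The rates are continuous. -/
  continuous : ∀ x j, Continuous fun η => c x η j
  /-- The rates are bounded away from zero. -/
  nondegenerate : ∃ κ : ℝ, 0 < κ ∧ ∀ x η j, κ ≤ c x η j
  /-- The rates are short-range. -/
  shortRange : ∑' y : Site d, ‖y‖ₑ * (⨆ x, ∑ j, osc (x + y) (jumpRate c x j)) < ∞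

/-- The space `D(Ω)` of continuous functions with finite total oscillation. -/
def smoothFunctions (d q : ℕ) : Set C(Config d q, ℝ) :=
  {f | ∑' x, osc x f < ∞}

/-- The formal generator `ℒ f(η) = ∑_x ∑_j c_x(η, j) [f(η^{x,j}) - f(η)]`. For bounded rates the
series converges absolutely and uniformly for every `f` in `D(Ω)`. -/
def preGenerator (c : Rates d q) (f : Config d q → ℝ) (η : Config d q) : ℝ :=
  ∑' x, ∑ j, c x η j * (f (Function.update η x j) - f η)

/-- `P` is the family of transition kernels of a Markov (Feller) semigroup on `C(Ω)`, acting by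
`P_t f(η) = ∫ f(ξ) P_t(η, dξ)`. -/
structure IsMarkovSemigroup (P : ℝ≥0 → Kernel (Config d q) (Config d q)) : Prop where
  markov : ∀ t, IsMarkovKernel (P t)
  zero : P 0 = Kernel.id
  add : ∀ s t, P (s + t) = P t ∘ₖ P s
  feller : ∀ t (f : C(Config d q, ℝ)), Continuous fun η => ∫ ξ, f ξ ∂(P t η)
  strongly_continuous : ∀ f : C(Config d q, ℝ),
    TendstoUniformly (fun t η => ∫ ξ, f ξ ∂(P t η)) f (𝓝 0)

/-- `P` is the Markov semigroup of the interacting particle system with rates `c`: it is a Markov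
semigroup, and its generator is given on the core `D(Ω)` by `ℒ`, i.e. `(P_t f - f) / t → ℒ f`
uniformly as `t ↓ 0` for all `f` in `D(Ω)`. -/
structure IsSemigroupOf (P : ℝ≥0 → Kernel (Config d q) (Config d q)) (c : Rates d q) : Prop where
  isMarkovSemigroup : IsMarkovSemigroup P
  generator : ∀ f ∈ smoothFunctions d q,
    TendstoUniformly (fun (t : ℝ≥0) η => (∫ ξ, f ξ ∂(P t η) - f η) / (t : ℝ))
      (preGenerator c f) (𝓝[>] 0)

/-- The time-evolved measure `ν P_t`. -/
def evolve (P : ℝ≥0 → Kernel (Config d q) (Config d q)) (ν : Measure (Config d q)) (t : ℝ≥0) :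
    Measure (Config d q) :=
  ν.bind (P t)

/-- `ν` is time-stationary: `ν P_t = ν` for all `t ≥ 0`. -/
def IsStationary (P : ℝ≥0 → Kernel (Config d q) (Config d q)) (ν : Measure (Config d q)) : Prop :=
  ∀ t, evolve P ν t = ν

/-- `μ` is a product probability measure; the one-site marginals may depend on the site. -/
def IsProductMeasure (μ : Measure (Config d q)) : Prop :=
  ∃ m : Site d → ProbabilityMeasure (Fin q),
    μ = Measure.infinitePi fun x => (m x : Measure (Fin q))

/-- The cylinder set `[ω_Λ]`. -/
def cyl (Λ : Finset (Site d)) (ω : Λ → Fin q) : Set (Config d q) :=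
  {η | Λ.restrict η = ω}

open Classical in
/-- The relative entropy `h_Λ(ν | μ)` in the finite volume `Λ`. -/
def relEntropy (Λ : Finset (Site d)) (ν μ : Measure (Config d q)) : EReal :=
  if ν.map Λ.restrict ≪ μ.map Λ.restrict then
    ((∑ ω : Λ → Fin q,
      ν.real (cyl Λ ω) * Real.log (ν.real (cyl Λ ω) / μ.real (cyl Λ ω)) : ℝ) : EReal)
  else ⊤

/-- The relative entropy loss `g_Λ(ν | μ)`: the right derivative of `t ↦ h_Λ(ν P_t | μ)` at
`t = 0`. -/
def entropyLoss (P : ℝ≥0 → Kernel (Config d q) (Config d q)) (Λ : Finset (Site d))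
    (ν μ : Measure (Config d q)) : ℝ :=
  derivWithin (fun t : ℝ => (relEntropy Λ (evolve P ν t.toNNReal) μ).toReal) (Set.Ici 0) 0

end IPS

end

/-! This is a Holley-Stroock argument applied to the time-integrated entropy loss. On a finite box
let `p` and `m` be the marginals of the evolved measure and of `μ`, and let `u = p / m`. The entropy
loss is a sum of terms `r p (log u' - log u)`, where `u'` is `u` after a single-site change and `r`
is the rate averaged over a cylinder. The inequality `A log (B / A) ≤ B - A - (√B - √A)²` extracts
from each term a Dirichlet energy of `√u`. The linear remainder would vanish by stationarity of `μ`
if `r` were the rate averaged under `μ`. Both averages run over the same cylinder, so they differ by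
at most the influence of the sites outside the box (`outerInfluence`). Hence the energy is bounded
by minus the entropy loss plus a boundary error (`sum_siteEnergy_le`).

Integration over `[0, T]` removes the entropy loss. Optimising a free parameter then bounds the
square of the total energy by the product of the total outer influence and the energy weighted by
outer influence (`sq_sum_timeEnergy_le`). In dimension one or two the first factor is `O(m)` for the
box of radius `m`, and the second is at most a weighted sum of increments `S m - S (m - k)` of the
energy `S`. Energies increase with the volume, so `S` is monotone, and divergence of the harmonic
series forces `S = 0` (`eq_zero_of_sq_le_tsum`).

The integrated energy is thus zero. Its integrand is continuous and nonnegative, so it vanishes at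
time zero, where it is an energy of `ν`. Zero energy at every site makes `u` constant, so all
marginals of `ν` and `μ` agree. -/

noncomputable section

namespace IPS

/-! ### Growth inequalities for real sequences -/

/-- Optimising `λ a + b / λ` over `λ > 0`. -/
lemma sq_le_of_forall_le_mul_add_div {s a b : ℝ} (hs : 0 ≤ s) (ha : 0 ≤ a) (hb : 0 ≤ b)
    (h : ∀ l : ℝ, 0 < l → s ≤ l * a + b / l) : s ^ 2 ≤ 4 * a * b := by
  -- Multiplied by `l`, the hypothesis says that a quadratic is nonnegative for `l > 0`. For `l ≤ 0`
  -- this is clear from the signs, so its discriminant is nonpositive.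
  have key : ∀ x : ℝ, 0 ≤ a * (x * x) + (-s) * x + b := by
    intro x
    rcases le_or_gt x 0 with hx | hx
    · nlinarith [mul_nonneg ha (mul_self_nonneg x), mul_nonneg hs (neg_nonneg.2 hx)]
    · have h1 := mul_le_mul_of_nonneg_right (h x hx) hx.le
      rw [add_mul, div_mul_cancel₀ _ hx.ne'] at h1
      nlinarith
  have := discrim_le_zero key
  rw [discrim] at this
  nlinarith

/-- A discrete differential inequality `Q² ≤ C n (Q_n - Q_{n-1})` forces `Q = 0`. -/
lemma eq_zero_of_sq_le_mul_sub {Q : ℕ → ℝ} {C : ℝ} (hQ0 : ∀ n, 0 ≤ Q n) (hC : 0 < C)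
    (h : ∀ n : ℕ, Q (n + 1) ^ 2 ≤ C * (n + 1) * (Q (n + 1) - Q n)) (N : ℕ) : Q N = 0 := by
  by_contra hne
  have hN : 0 < Q N := lt_of_le_of_ne (hQ0 N) (Ne.symm hne)
  have hmono : Monotone Q := by
    refine monotone_nat_of_le_succ fun n => ?_
    have h1 : 0 ≤ C * (n + 1) * (Q (n + 1) - Q n) := (sq_nonneg _).trans (h n)
    have h2 : (0 : ℝ) < C * (n + 1) := by positivity
    linarith [nonneg_of_mul_nonneg_right h1 h2]
  -- By monotonicity `Q n * Q (n + 1) ≤ Q (n + 1) ^ 2`. Dividing the hypothesis by this product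
  -- gives a telescoping bound on the harmonic terms.
  have hstep : ∀ n, N ≤ n → 1 / (n + 1 : ℝ) ≤ C * (1 / Q n - 1 / Q (n + 1)) := by
    intro n hn
    have hq : 0 < Q n := hN.trans_le (hmono hn)
    have hle : Q n ≤ Q (n + 1) := hmono n.le_succ
    have hq' : 0 < Q (n + 1) := hq.trans_le hle
    have hn1 : (0 : ℝ) < n + 1 := by positivity
    rw [div_sub_div _ _ hq.ne' hq'.ne', mul_div_assoc', div_le_div_iff₀ hn1 (by positivity)]
    nlinarith [h n, mul_nonneg (sub_nonneg.2 hle) hq'.le]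
  have hsum : ∀ n, N ≤ n → ∑ i ∈ Finset.Ico N n, 1 / (i + 1 : ℝ) ≤ C * (1 / Q N - 1 / Q n) := by
    intro n hn
    induction n, hn using Nat.le_induction with
    | base => simp
    | succ n hn ih =>
      rw [Finset.sum_Ico_succ_top hn]
      linarith [hstep n hn]
  have hdiv := Real.tendsto_sum_range_one_div_nat_succ_atTop
  obtain ⟨n, hn, hn'⟩ := ((tendsto_atTop.1 hdiv
    (∑ i ∈ Finset.range N, 1 / (i + 1 : ℝ) + C * (1 / Q N) + 1)).and
      (eventually_ge_atTop N)).exists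
  have h1 := hsum n hn'
  rw [← Finset.sum_range_add_sum_Ico _ hn'] at hn
  have h2 : 0 ≤ C * (1 / Q n) := mul_nonneg hC.le (one_div_nonneg.2 (hQ0 n))
  linarith [mul_sub C (1 / Q N) (1 / Q n)]

/-- A difference over `k` steps is a sum of `k` one-step differences, and each of these telescopes
over `m`. Truncated subtraction does no harm because `S 0 = 0`. -/
lemma sum_sub_sub_le_mul {S : ℕ → ℝ} (hS : Monotone S) (hS0 : S 0 = 0) (k M : ℕ) :
    ∑ m ∈ Finset.range M, (S (m + 1) - S (m + 1 - k)) ≤ k * S M := by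
  induction k with
  | zero => simp
  | succ k ih =>
    have h1 : ∑ m ∈ Finset.range M, (S (m + 1 - k) - S (m + 1 - (k + 1))) ≤ S M := by
      have : ∀ M, ∑ m ∈ Finset.range M, (S (m + 1 - k) - S (m + 1 - (k + 1))) = S (M - k) := by
        intro M
        induction M with
        | zero => simp [hS0]
        | succ M ih =>
          rw [Finset.sum_range_succ, ih, Nat.add_sub_add_right]
          ring
      rw [this]
      exact hS (Nat.sub_le _ _)
    have h2 : ∑ m ∈ Finset.range M, (S (m + 1) - S (m + 1 - (k + 1))) =
        ∑ m ∈ Finset.range M, (S (m + 1) - S (m + 1 - k)) +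
        ∑ m ∈ Finset.range M, (S (m + 1 - k) - S (m + 1 - (k + 1))) := by
      rw [← Finset.sum_add_distrib]
      exact Finset.sum_congr rfl fun _ _ => by ring
    rw [h2, Nat.cast_succ, add_mul, one_mul]
    exact add_le_add ih h1

/-- The growth lemma behind the Holley-Stroock argument in dimensions one and two. -/
lemma eq_zero_of_sq_le_tsum {ι : Type*} {S : ℕ → ℝ} (hS : Monotone S) (hS0 : S 0 = 0)
    {D : ι → ℝ} {k : ι → ℕ} (hD : ∀ z, 0 ≤ D z) (hD0 : Summable D)
    (hDk : Summable fun z => k z * D z) {C : ℝ} (hC : 0 ≤ C)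
    (h : ∀ n : ℕ, S n ^ 2 ≤ C * n * ∑' z, D z * (S n - S (n - k z))) (N : ℕ) : S N = 0 := by
  have hSn : ∀ n, 0 ≤ S n := fun n => hS0 ▸ hS (Nat.zero_le n)
  have hterm : ∀ n, Summable fun z => D z * (S n - S (n - k z)) := by
    intro n
    refine Summable.of_nonneg_of_le (fun z => mul_nonneg (hD z) (sub_nonneg.2 (hS (Nat.sub_le _ _))))
      (fun z => ?_) (hD0.mul_right (S n))
    exact mul_le_mul_of_nonneg_left (by linarith [hSn (n - k z)]) (hD z)
  set K := ∑' z, k z * D z with hK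
  have hK0 : 0 ≤ K := tsum_nonneg fun z => mul_nonneg (Nat.cast_nonneg _) (hD z)
  -- Dividing by `m` and summing turns the nonlocal increments into `K * S M`. Thus `Q ≤ C K S`,
  -- while `S²` is recovered from the increments of `Q`.
  let Q : ℕ → ℝ := fun M => ∑ m ∈ Finset.range M, S (m + 1) ^ 2 / (m + 1)
  have hQ0 : ∀ n, 0 ≤ Q n := fun n => Finset.sum_nonneg fun m _ => by positivity
  have hQS : ∀ M, Q M ≤ C * K * S M := by
    intro M
    have h1 : Q M ≤ ∑ m ∈ Finset.range M,
        C * ∑' z, D z * (S (m + 1) - S (m + 1 - k z)) := by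
      refine Finset.sum_le_sum fun m _ => ?_
      rw [div_le_iff₀ (by positivity)]
      have := h (m + 1)
      push_cast at this
      linarith
    rw [← Finset.mul_sum, ← Summable.tsum_finsetSum fun m _ => hterm (m + 1)] at h1
    refine h1.trans ?_
    rw [mul_assoc]
    refine mul_le_mul_of_nonneg_left ?_ hC
    rw [hK, ← tsum_mul_right]
    refine Summable.tsum_le_tsum (fun z => ?_) (summable_sum fun m _ => hterm (m + 1))
      (hDk.mul_right _)
    rw [← Finset.mul_sum]
    calc _ ≤ D z * (k z * S M) := mul_le_mul_of_nonneg_left (sum_sub_sub_le_mul hS hS0 _ _) (hD z)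
      _ = _ := by ring
  -- The `+ 1` only makes the constant positive when `C * K = 0`.
  have hQ := eq_zero_of_sq_le_mul_sub (Q := Q) (C := (C * K) ^ 2 + 1) hQ0 (by positivity)
    (fun n => by
      have h1 : Q (n + 1) - Q n = S (n + 1) ^ 2 / (n + 1) := by
        simp only [Q, Finset.sum_range_succ]; ring
      rw [h1, mul_assoc, mul_div_cancel₀ _ (by positivity)]
      have h2 := pow_le_pow_left₀ (hQ0 _) (hQS (n + 1)) 2
      rw [mul_pow] at h2
      nlinarith [sq_nonneg (S (n + 1))])
  rcases N with _ | n
  · exact hS0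
  · have h1 : Q (n + 1) - Q n = S (n + 1) ^ 2 / (n + 1) := by
      simp only [Q, Finset.sum_range_succ]; ring
    rw [hQ, hQ, sub_zero, eq_comm, div_eq_zero_iff] at h1
    rcases h1 with h1 | h1
    · exact pow_eq_zero_iff (two_ne_zero) |>.1 h1
    · exact absurd h1 (by positivity)

/-! ### Energy and entropy production on a finite product space -/

section Finite

variable {ι ι' α : Type*} [Fintype ι] [DecidableEq ι] [Fintype ι'] [DecidableEq ι']
  [Fintype α]

/-- The Dirichlet form at the site `x` of the square root of the density of `p` with respect to a
product measure whose marginal at `x` has weights `θ`. -/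
def siteEnergy (θ : α → ℝ) (x : ι) (p : (ι → α) → ℝ) : ℝ :=
  ∑ j, ∑ σ, (√(θ (σ x) / θ j * p (Function.update σ x j)) - √(p σ)) ^ 2

lemma siteEnergy_nonneg (θ : α → ℝ) (x : ι) (p : (ι → α) → ℝ) : 0 ≤ siteEnergy θ x p :=
  Finset.sum_nonneg fun _ _ => Finset.sum_nonneg fun _ _ => sq_nonneg _

/-- Exchanging the old and the new state at `x` is an involution of the pairs `(j, σ)`. -/
lemma sum_sum_update (p : (ι → α) → ℝ) (x : ι) :
    ∑ j, ∑ σ, p (Function.update σ x j) = Fintype.card α * ∑ σ, p σ := by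
  have hinv : Function.Involutive
      fun a : α × (ι → α) => (a.2 x, Function.update a.2 x a.1) := by
    rintro ⟨j, σ⟩
    simp
  have h := Equiv.sum_comp hinv.toPerm fun a : α × (ι → α) => p a.2
  rw [Fintype.sum_prod_type, Fintype.sum_prod_type] at h
  simpa using h

lemma sqrt_sub_sqrt_sq {A B : ℝ} (hA : 0 ≤ A) (hB : 0 ≤ B) :
    (√B - √A) ^ 2 = B + A - 2 * (√B * √A) := by
  rw [sub_sq, Real.sq_sqrt hA, Real.sq_sqrt hB]
  ring

/-- This is `log t ≤ t - 1` at `t = √B / √A`; taking square roots first leaves the quadratic gain.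
-/
lemma sqrt_sub_sqrt_sq_le {A B : ℝ} (hA : 0 < A) (hB : 0 < B) :
    (√B - √A) ^ 2 ≤ B - A - A * (Real.log B - Real.log A) := by
  have hsA := Real.sqrt_pos.2 hA
  have hsB := Real.sqrt_pos.2 hB
  have h1 : Real.log B - Real.log A = 2 * Real.log (√B / √A) := by
    rw [Real.log_div hsB.ne' hsA.ne', Real.log_sqrt hB.le, Real.log_sqrt hA.le]
    ring
  have h2 := Real.log_le_sub_one_of_pos (div_pos hsB hsA)
  have h3 : A * (√B / √A) = √B * √A := by
    have : A = √A * √A := (Real.mul_self_sqrt hA.le).symm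
    rw [mul_div_assoc', div_eq_iff hsA.ne']
    nlinarith
  rw [sqrt_sub_sqrt_sq hA.le hB.le, h1]
  nlinarith [mul_le_mul_of_nonneg_left h2 hA.le]

/-- Factor `B - A` through the square roots, apply Young's inequality with weight `l`, and use `(√A
+ √B)² ≤ 2 (A + B)`. -/
lemma abs_sub_le_sqrt_sub_sqrt_sq {A B l : ℝ} (hA : 0 ≤ A) (hB : 0 ≤ B) (hl : 0 < l) :
    |B - A| ≤ l * (√B - √A) ^ 2 + (A + B) / (2 * l) := by
  have hsA := Real.sqrt_nonneg A
  have hsB := Real.sqrt_nonneg B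
  have h1 : |B - A| = |√B - √A| * (√B + √A) := by
    rw [← abs_of_nonneg (add_nonneg hsB hsA), ← abs_mul]
    congr 1
    nlinarith [Real.mul_self_sqrt hA, Real.mul_self_sqrt hB]
  have h2 : (√B + √A) ^ 2 ≤ 2 * (A + B) := by
    nlinarith [sq_nonneg (√B - √A), Real.sq_sqrt hA, Real.sq_sqrt hB]
  have h3 : (√B + √A) ^ 2 / (4 * l) ≤ (A + B) / (2 * l) := by
    rw [div_le_div_iff₀ (by positivity) (by positivity)]
    nlinarith
  refine le_trans ?_ (add_le_add_right h3 _)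
  rw [h1, ← sq_abs (√B - √A), ← sub_nonneg]
  have : l * |√B - √A| ^ 2 + (√B + √A) ^ 2 / (4 * l) - |√B - √A| * (√B + √A) =
      (2 * l * |√B - √A| - (√B + √A)) ^ 2 / (4 * l) := by
    field_simp
    ring
  rw [this]
  positivity

/-- The linear term `r (B - A)` is traded for `s (B - A)`, which stationarity will cancel after
summation; the cost is the `ε` term. The case `A = B` covers updates that change nothing, for which
the rates are not compared. -/
lemma dissipation_term_le {A B κ r s ε l : ℝ} (hA : 0 < A) (hB : 0 < B) (hκ : 0 ≤ κ)
    (hr : κ ≤ r)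
    (hε : A = B ∨ |r - s| ≤ ε) (hl : 0 < l) (hε0 : 0 ≤ ε) :
    κ * (√B - √A) ^ 2 ≤ -(r * A * (Real.log B - Real.log A)) + s * (B - A) +
      ε * (l * (√B - √A) ^ 2 + (A + B) / (2 * l)) := by
  rcases hε with rfl | hε
  · simp only [sub_self, ne_eq, OfNat.ofNat_ne_zero, not_false_eq_true, zero_pow, mul_zero,
      neg_zero, add_zero, zero_add]
    positivity
  · have h1 := sqrt_sub_sqrt_sq_le hA hB
    have h2 := mul_le_mul_of_nonneg_left h1 (hκ.trans hr)
    have h3 := mul_le_mul_of_nonneg_right hr (sq_nonneg (√B - √A))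
    have h4 : (r - s) * (B - A) ≤ ε * |B - A| :=
      (le_abs_self _).trans ((abs_mul _ _).le.trans
        (mul_le_mul_of_nonneg_right hε (abs_nonneg _)))
    have h5 := mul_le_mul_of_nonneg_left (abs_sub_le_sqrt_sub_sqrt_sq hA.le hB.le hl) hε0
    linarith

/-- The comparison of entropy loss and energy for a probability vector `p` and a product
probability vector `m` (with site weights `θ`) on a finite volume. Here `r` and `s` are the
conditional transition rates under `p` and `m`. -/
lemma sum_siteEnergy_le {p m : (ι → α) → ℝ} {θ : ι → α → ℝ} {r s : ι → α → (ι → α) → ℝ}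
    {ε : ι → ℝ} {κ δ l : ℝ} (hp : ∀ σ, 0 < p σ) (hm : ∀ σ, 0 < m σ) (hp1 : ∑ σ, p σ = 1)
    (hδ : 0 < δ) (hθ : ∀ x j, δ ≤ θ x j) (hθ1 : ∀ x j, θ x j ≤ 1)
    (hmθ : ∀ x j σ, m σ * θ x j = m (Function.update σ x j) * θ x (σ x))
    (hκ : 0 ≤ κ) (hr : ∀ x j σ, κ ≤ r x j σ) (hε0 : ∀ x, 0 ≤ ε x)
    (hε : ∀ x j σ, σ x ≠ j → |r x j σ - s x j σ| ≤ ε x)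
    (hstat : ∑ x, ∑ j, ∑ σ, s x j σ * m σ *
      (p (Function.update σ x j) / m (Function.update σ x j) - p σ / m σ) = 0) (hl : 0 < l) :
    κ * ∑ x, siteEnergy (θ x) x p ≤
      -(∑ x, ∑ j, ∑ σ, r x j σ * p σ *
        (Real.log (p (Function.update σ x j) / m (Function.update σ x j)) -
          Real.log (p σ / m σ))) +
      ∑ x, ε x * (l * siteEnergy (θ x) x p + Fintype.card α * (1 + δ⁻¹) / (2 * l)) := by
  have hθ0 : ∀ x j, 0 < θ x j := fun x j => hδ.trans_le (hθ x j)
  -- With this ratio, `siteEnergy` compares `m σ * u σ'` with `m σ * u σ`, where `u = p / m` and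
  -- `σ'` is the updated configuration.
  have hw : ∀ x j σ, θ x (σ x) / θ x j = m σ / m (Function.update σ x j) := by
    intro x j σ
    rw [div_eq_div_iff (hθ0 x j).ne' (hm _).ne', hmθ x j σ, mul_comm]
  have hw1 : ∀ x j (σ : ι → α), θ x (σ x) / θ x j ≤ δ⁻¹ := by
    intro x j σ
    rw [div_eq_mul_inv]
    calc _ ≤ 1 * (θ x j)⁻¹ :=
          mul_le_mul_of_nonneg_right (hθ1 _ _) (inv_nonneg.2 (hθ0 _ _).le)
      _ ≤ _ := by rw [one_mul]; exact inv_anti₀ hδ (hθ x j)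
  have hterm : ∀ x j σ, κ * (√(θ x (σ x) / θ x j * p (Function.update σ x j)) - √(p σ)) ^ 2 ≤
      -(r x j σ * p σ * (Real.log (p (Function.update σ x j) / m (Function.update σ x j)) -
          Real.log (p σ / m σ))) +
      s x j σ * m σ *
        (p (Function.update σ x j) / m (Function.update σ x j) - p σ / m σ) +
      ε x * (l * (√(θ x (σ x) / θ x j * p (Function.update σ x j)) - √(p σ)) ^ 2 +
        (p σ + δ⁻¹ * p (Function.update σ x j)) / (2 * l)) := by
    intro x j σ
    set σ' := Function.update σ x j with hσ'
    have hB : 0 < θ x (σ x) / θ x j * p σ' := mul_pos (div_pos (hθ0 _ _) (hθ0 _ _)) (hp _)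
    have h := dissipation_term_le (κ := κ) (r := r x j σ) (s := s x j σ) (ε := ε x) (hp σ) hB hκ
      (hr x j σ) (by
        by_cases hj : σ x = j
        · left
          have : σ' = σ := by rw [hσ', ← hj, Function.update_eq_self]
          rw [this, ← hj, div_self (hθ0 _ _).ne', one_mul]
        · exact Or.inr (hε x j σ hj)) hl (hε0 x)
    have h1 : Real.log (θ x (σ x) / θ x j * p σ') - Real.log (p σ) =
        Real.log (p σ' / m σ') - Real.log (p σ / m σ) := by
      rw [hw, ← hσ', Real.log_mul (div_pos (hm _) (hm _)).ne' (hp _).ne',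
        Real.log_div (hm _).ne' (hm _).ne', Real.log_div (hp _).ne' (hm _).ne',
        Real.log_div (hp _).ne' (hm _).ne']
      ring
    have h2 : s x j σ * (θ x (σ x) / θ x j * p σ' - p σ) =
        s x j σ * m σ * (p σ' / m σ' - p σ / m σ) := by
      rw [hw, ← hσ']
      have := (hm σ).ne'
      have := (hm σ').ne'
      field_simp
    rw [h1, h2] at h
    refine h.trans (add_le_add_right (mul_le_mul_of_nonneg_left (add_le_add_right ?_ _)
      (hε0 x)) _)
    refine div_le_div_of_nonneg_right (add_le_add_right ?_ _) (by positivity)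
    exact mul_le_mul_of_nonneg_right (hw1 x j σ) (hp _).le
  have hx : ∀ x, ∑ j, ∑ σ, (p σ + δ⁻¹ * p (Function.update σ x j)) / (2 * l) =
      Fintype.card α * (1 + δ⁻¹) / (2 * l) := by
    intro x
    simp_rw [← Finset.sum_div, Finset.sum_add_distrib, ← Finset.mul_sum, sum_sum_update, hp1]
    simp
    ring
  calc κ * ∑ x, siteEnergy (θ x) x p
      = ∑ x, ∑ j, ∑ σ,
        κ * (√(θ x (σ x) / θ x j * p (Function.update σ x j)) - √(p σ)) ^ 2 := by
        simp only [siteEnergy, Finset.mul_sum]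
    _ ≤ _ := Finset.sum_le_sum fun x _ => Finset.sum_le_sum fun j _ => Finset.sum_le_sum
        fun σ _ => hterm x j σ
    _ = _ := by
        simp only [Finset.sum_add_distrib, hstat, Finset.sum_neg_distrib, add_zero]
        congr 1
        refine Finset.sum_congr rfl fun x _ => ?_
        simp only [← Finset.mul_sum, Finset.sum_add_distrib, hx, siteEnergy]

/-- This is the reverse triangle inequality in `ℓ²`; the cross term is Cauchy-Schwarz. -/
lemma sqrt_sum_sub_sqrt_sum_sq_le {β : Type*} (s : Finset β) {f g : β → ℝ} (hf : ∀ i, 0 ≤ f i)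
    (hg : ∀ i, 0 ≤ g i) :
    (√(∑ i ∈ s, f i) - √(∑ i ∈ s, g i)) ^ 2 ≤ ∑ i ∈ s, (√(f i) - √(g i)) ^ 2 := by
  rw [sqrt_sub_sqrt_sq (Finset.sum_nonneg fun i _ => hg i) (Finset.sum_nonneg fun i _ => hf i)]
  simp_rw [fun i => sqrt_sub_sqrt_sq (hg i) (hf i)]
  rw [Finset.sum_sub_distrib, Finset.sum_add_distrib, ← Finset.mul_sum]
  have := Real.sum_sqrt_mul_sqrt_le s hf hg
  linarith

/-- The energy at a site decreases when passing to marginals. -/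
lemma siteEnergy_marginal_le [DecidableEq α] {θ : α → ℝ} (hθ : ∀ j, 0 < θ j) {i : ι → ι'}
    (hi : Function.Injective i) (x : ι) {p : (ι → α) → ℝ} {p' : (ι' → α) → ℝ}
    (hp' : ∀ σ, 0 ≤ p' σ) (hp : ∀ ω, p ω = ∑ σ with σ ∘ i = ω, p' σ) :
    siteEnergy θ x p ≤ siteEnergy θ (i x) p' := by
  have hup : ∀ (σ : ι' → α) (j : α),
      Function.update σ (i x) j ∘ i = Function.update (σ ∘ i) x j := by
    intro σ j
    exact Function.update_comp_eq_of_injective _ hi _ _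
  refine Finset.sum_le_sum fun j _ => ?_
  rw [← Finset.sum_fiberwise Finset.univ (fun σ : ι' → α => σ ∘ i)]
  refine Finset.sum_le_sum fun ω _ => ?_
  -- The fibre over the updated `ω` is parametrised by the fibre over `ω`, so that the two sums can
  -- be compared term by term.
  have hshift : p (Function.update ω x j) =
      ∑ σ with σ ∘ i = ω, p' (Function.update σ (i x) j) := by
    rw [hp]
    refine Finset.sum_nbij' (fun σ => Function.update σ (i x) (ω x))
      (fun σ => Function.update σ (i x) j) ?_ ?_ ?_ ?_ ?_
    · intro σ hσ
      simp only [Finset.mem_filter, Finset.mem_univ, true_and] at hσ ⊢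
      rw [hup, hσ]
      simp
    · intro σ hσ
      simp only [Finset.mem_filter, Finset.mem_univ, true_and] at hσ ⊢
      rw [hup, hσ]
    · intro σ hσ
      simp only [Finset.mem_filter, Finset.mem_univ, true_and] at hσ
      have := congrFun hσ x
      simp at this
      simp [← this]
    · intro σ hσ
      simp only [Finset.mem_filter, Finset.mem_univ, true_and] at hσ
      have := congrFun hσ x
      simp at this
      simp [← this]
    · intro σ hσ
      simp only [Finset.mem_filter, Finset.mem_univ, true_and] at hσ
      have := congrFun hσ x
      simp at this
      simp [← this]
  rw [hshift, hp, Finset.mul_sum]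
  refine (sqrt_sum_sub_sqrt_sum_sq_le _ (fun σ => mul_nonneg (div_pos (hθ _) (hθ _)).le (hp' _))
    hp').trans (Finset.sum_le_sum fun σ hσ => ?_)
  simp only [Finset.mem_filter, Finset.mem_univ, true_and] at hσ
  rw [← hσ]
  rfl

/-- The ratio `p / m` is unchanged by single-site updates. These connect any two configurations, so
the ratio is constant, and normalisation makes it one. -/
lemma eq_of_siteEnergy_eq_zero {p m : (ι → α) → ℝ} {θ : ι → α → ℝ} (hp : ∀ σ, 0 < p σ)
    (hm : ∀ σ, 0 < m σ) (hp1 : ∑ σ, p σ = 1) (hm1 : ∑ σ, m σ = 1) (hθ : ∀ x j, 0 < θ x j)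
    (hmθ : ∀ x j σ, m σ * θ x j = m (Function.update σ x j) * θ x (σ x))
    (h0 : ∀ x, siteEnergy (θ x) x p = 0) : p = m := by
  have h1 : ∀ x j σ, p (Function.update σ x j) / m (Function.update σ x j) = p σ / m σ := by
    intro x j σ
    have h := h0 x
    rw [siteEnergy, Finset.sum_eq_zero_iff_of_nonneg fun _ _ =>
      Finset.sum_nonneg fun _ _ => sq_nonneg _] at h
    have h := h j (Finset.mem_univ _)
    rw [Finset.sum_eq_zero_iff_of_nonneg fun _ _ => sq_nonneg _] at h
    have h := h σ (Finset.mem_univ _)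
    rw [sq_eq_zero_iff, sub_eq_zero, Real.sqrt_inj
      (mul_pos (div_pos (hθ _ _) (hθ _ _)) (hp _)).le (hp _).le] at h
    have hw : θ x (σ x) / θ x j = m σ / m (Function.update σ x j) := by
      rw [div_eq_div_iff (hθ x j).ne' (hm _).ne', hmθ x j σ, mul_comm]
    rw [hw] at h
    rw [← h]
    have := (hm σ).ne'
    have := (hm (Function.update σ x j)).ne'
    field_simp
  have h2 : ∀ σ τ, p τ / m τ = p σ / m σ := by
    intro σ τ
    have : ∀ s : Finset ι, p (s.piecewise τ σ) / m (s.piecewise τ σ) = p σ / m σ := by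
      intro s
      induction s using Finset.induction_on with
      | empty => simp
      | insert x s _ ih => rw [Finset.piecewise_insert, h1, ih]
    simpa using this Finset.univ
  funext σ
  have h3 : ∀ τ, p τ = p σ / m σ * m τ := fun τ => by
    rw [← h2 σ τ, div_mul_cancel₀ _ (hm τ).ne']
  have h4 : p σ / m σ = 1 := by
    have : ∑ τ, p τ = p σ / m σ * ∑ τ, m τ := by
      rw [Finset.mul_sum]
      exact Finset.sum_congr rfl fun τ _ => h3 τ
    rwa [hp1, hm1, mul_one, eq_comm] at this
  rwa [div_eq_one_iff_eq (hm σ).ne'] at h4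

end Finite

variable {d q : ℕ}

/-! ### Cylinder functions and the generator -/

section Cylinders

lemma restrict_update_of_mem {Λ : Finset (Site d)} (x : Λ) (η : Config d q) (j : Fin q) :
    Λ.restrict (Function.update η x j) = Function.update (Λ.restrict η) x j := by
  funext y
  by_cases h : y = x
  · subst h; simp
  · have : (y : Site d) ≠ x := fun h' => h (Subtype.ext h')
    simp [Function.update_of_ne h, Function.update_of_ne this]

lemma restrict_update_of_notMem {Λ : Finset (Site d)} {x : Site d} (hx : x ∉ Λ)
    (η : Config d q) (j : Fin q) : Λ.restrict (Function.update η x j) = Λ.restrict η := by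
  funext y
  have : (y : Site d) ≠ x := fun h => hx (h ▸ y.2)
  simp [Function.update_of_ne this]

lemma continuous_comp_restrict {β : Type*} [TopologicalSpace β] (Λ : Finset (Site d))
    (F : (Λ → Fin q) → β) : Continuous fun η : Config d q => F (Λ.restrict η) :=
  (continuous_of_discreteTopology (f := F)).comp (Finset.continuous_restrict Λ)

/-- A function of the configuration in `Λ`, as a continuous function. -/
def cylinderFun (Λ : Finset (Site d)) (F : (Λ → Fin q) → ℝ) : C(Config d q, ℝ) :=
  ⟨fun η => F (Λ.restrict η), continuous_comp_restrict Λ F⟩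

lemma measurableSet_cyl (Λ : Finset (Site d)) (ω : Λ → Fin q) : MeasurableSet (cyl Λ ω) :=
  measurableSet_preimage (Finset.measurable_restrict (X := fun _ : Site d => Fin q) Λ)
    (measurableSet_singleton ω)

lemma integrable_of_continuous (ρ : Measure (Config d q)) [IsFiniteMeasure ρ]
    {f : Config d q → ℝ} (hf : Continuous f) : Integrable f ρ :=
  (BoundedContinuousFunction.mkOfCompact ⟨f, hf⟩).integrable ρ

lemma integral_mul_comp_restrict (ρ : Measure (Config d q)) [IsFiniteMeasure ρ]
    (Λ : Finset (Site d)) {g : Config d q → ℝ} (hg : Continuous g) (G : (Λ → Fin q) → ℝ) :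
    ∫ η, g η * G (Λ.restrict η) ∂ρ = ∑ σ, (∫ η in cyl Λ σ, g η ∂ρ) * G σ := by
  have h : ∀ η, g η * G (Λ.restrict η) =
      ∑ σ, (cyl Λ σ).indicator (fun η => g η * G σ) η := by
    intro η
    rw [Finset.sum_eq_single (Λ.restrict η)]
    · rw [Set.indicator_of_mem (show η ∈ cyl Λ (Λ.restrict η) from rfl)]
    · intro σ _ hσ
      rw [Set.indicator_of_notMem fun h : η ∈ cyl Λ σ => hσ (Eq.symm h)]
    · simp
  simp_rw [h]
  rw [integral_finsetSum]
  · refine Finset.sum_congr rfl fun σ _ => ?_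
    rw [integral_indicator (measurableSet_cyl Λ σ), integral_mul_const]
  · exact fun σ _ => ((integrable_of_continuous ρ hg).mul_const _).indicator
      (measurableSet_cyl Λ σ)

lemma integral_cylinderFun (ρ : Measure (Config d q)) [IsFiniteMeasure ρ]
    (Λ : Finset (Site d)) (F : (Λ → Fin q) → ℝ) :
    ∫ η, cylinderFun Λ F η ∂ρ = ∑ σ, ρ.real (cyl Λ σ) * F σ := by
  have := integral_mul_comp_restrict ρ Λ (g := fun _ => 1) continuous_const F
  simpa [cylinderFun] using this

lemma real_cyl_eq_integral (ρ : Measure (Config d q)) [IsFiniteMeasure ρ]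
    (Λ : Finset (Site d)) (ω : Λ → Fin q) :
    ρ.real (cyl Λ ω) = ∫ η, cylinderFun Λ (Pi.single ω 1) η ∂ρ := by
  simp [integral_cylinderFun, Pi.single_apply]

lemma sum_real_cyl (ρ : Measure (Config d q)) [IsProbabilityMeasure ρ] (Λ : Finset (Site d)) :
    ∑ σ : Λ → Fin q, ρ.real (cyl Λ σ) = 1 := by
  have := integral_cylinderFun ρ Λ fun _ => 1
  simpa [cylinderFun] using this.symm

lemma real_cyl_marginal (ρ : Measure (Config d q)) [IsFiniteMeasure ρ]
    {Λ Δ : Finset (Site d)} (h : Λ ⊆ Δ) (ω : Λ → Fin q) :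
    ρ.real (cyl Λ ω) =
      ∑ σ : Δ → Fin q with σ ∘ Set.inclusion h = ω, ρ.real (cyl Δ σ) := by
  have h1 : cylinderFun Λ (Pi.single ω (1 : ℝ)) =
      cylinderFun Δ fun σ : Δ → Fin q => if σ ∘ Set.inclusion h = ω then 1 else 0 := by
    ext η
    simp only [cylinderFun, Pi.single_apply, ContinuousMap.coe_mk]
    rfl
  rw [real_cyl_eq_integral, h1, integral_cylinderFun, Finset.sum_filter]
  simp

lemma osc_comp_restrict_of_notMem {Λ : Finset (Site d)} (F : (Λ → Fin q) → ℝ) {x : Site d}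
    (hx : x ∉ Λ) : osc x (cylinderFun Λ F) = 0 := by
  simp only [osc, ENNReal.iSup_eq_zero]
  intro η ξ h
  have : Λ.restrict η = Λ.restrict ξ := by
    funext y
    exact h y fun h' => hx (h' ▸ y.2)
  simp [cylinderFun, this]

lemma cylinderFun_mem_smoothFunctions (Λ : Finset (Site d)) (F : (Λ → Fin q) → ℝ) :
    cylinderFun Λ F ∈ smoothFunctions d q := by
  change ∑' x, osc x (cylinderFun Λ F) < ∞
  rw [tsum_eq_sum (s := Λ) fun x hx => osc_comp_restrict_of_notMem F hx]
  refine ENNReal.sum_lt_top.2 fun x _ => ?_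
  refine lt_of_le_of_lt (b := ∑ σ, ∑ τ, ‖F σ - F τ‖ₑ) ?_
    (ENNReal.sum_lt_top.2 fun σ _ => ENNReal.sum_lt_top.2 fun τ _ => enorm_lt_top)
  refine iSup_le fun η => iSup_le fun ξ => iSup_le fun _ => ?_
  refine le_trans ?_ (Finset.single_le_sum (fun _ _ => zero_le) (Finset.mem_univ (Λ.restrict η)))
  exact Finset.single_le_sum (f := fun τ => ‖F (Λ.restrict η) - F τ‖ₑ) (fun _ _ => zero_le)
    (Finset.mem_univ (Λ.restrict ξ))

lemma preGenerator_cylinderFun (c : Rates d q) (Λ : Finset (Site d)) (F : (Λ → Fin q) → ℝ)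
    (η : Config d q) : preGenerator c (cylinderFun Λ F) η =
      ∑ x : Λ, ∑ j, c x η j *
        (F (Function.update (Λ.restrict η) x j) - F (Λ.restrict η)) := by
  rw [preGenerator, tsum_eq_sum (s := Λ), ← Finset.sum_coe_sort]
  · simp [cylinderFun, restrict_update_of_mem]
  · intro x hx
    simp [cylinderFun, restrict_update_of_notMem hx]

lemma integral_preGenerator_cylinderFun {c : Rates d q} (hc : ∀ x j, Continuous fun η => c x η j)
    (ρ : Measure (Config d q)) [IsFiniteMeasure ρ] (Λ : Finset (Site d))
    (F : (Λ → Fin q) → ℝ) :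
    ∫ η, preGenerator c (cylinderFun Λ F) η ∂ρ = ∑ x : Λ, ∑ j, ∑ σ,
      (∫ η in cyl Λ σ, c x η j ∂ρ) * (F (Function.update σ x j) - F σ) := by
  simp_rw [preGenerator_cylinderFun]
  have hint : ∀ (x : Λ) j, Integrable (fun η => c x η j *
      (F (Function.update (Λ.restrict η) x j) - F (Λ.restrict η))) ρ := fun x j =>
    integrable_of_continuous ρ ((hc x j).mul
      (continuous_comp_restrict Λ fun σ => F (Function.update σ x j) - F σ))
  rw [integral_finsetSum _ fun x _ => integrable_finsetSum _ fun j _ => hint x j]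
  refine Finset.sum_congr rfl fun x _ => ?_
  rw [integral_finsetSum _ fun j _ => hint x j]
  refine Finset.sum_congr rfl fun j _ => ?_
  exact integral_mul_comp_restrict ρ Λ (hc x j) fun σ => F (Function.update σ x j) - F σ

end Cylinders

/-! ### Time evolution and the entropy loss formula -/

section Evolution

variable {P : ℝ≥0 → Kernel (Config d q) (Config d q)}

lemma IsMarkovSemigroup.isProbabilityMeasure_evolve (hP : IsMarkovSemigroup P)
    (ρ : Measure (Config d q)) [IsProbabilityMeasure ρ] (t : ℝ≥0) :
    IsProbabilityMeasure (evolve P ρ t) := by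
  have := hP.markov t
  change IsProbabilityMeasure (P t ∘ₘ ρ)
  infer_instance

lemma IsMarkovSemigroup.evolve_zero (hP : IsMarkovSemigroup P) (ρ : Measure (Config d q)) :
    evolve P ρ 0 = ρ := by
  rw [evolve, hP.zero]
  exact Measure.id_comp

lemma IsMarkovSemigroup.evolve_add (hP : IsMarkovSemigroup P) (ρ : Measure (Config d q))
    (s t : ℝ≥0) : evolve P ρ (s + t) = evolve P (evolve P ρ s) t := by
  rw [evolve, hP.add]
  exact Measure.comp_assoc.symm

lemma IsMarkovSemigroup.integral_evolve (hP : IsMarkovSemigroup P) (ρ : Measure (Config d q))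
    [IsProbabilityMeasure ρ] (t : ℝ≥0) (f : C(Config d q, ℝ)) :
    ∫ η, f η ∂(evolve P ρ t) = ∫ η, ∫ ξ, f ξ ∂(P t η) ∂ρ := by
  have := hP.markov t
  have := hP.isProbabilityMeasure_evolve ρ t
  have hf := integrable_of_continuous (evolve P ρ t) f.continuous
  have he : evolve P ρ t = (P t ∘ₖ Kernel.const Unit ρ) () := Measure.comp_eq_comp_const_apply
  rw [he] at hf ⊢
  rw [Kernel.integral_comp hf, Kernel.const_apply]

lemma IsMarkovSemigroup.continuous_integral_evolve (hP : IsMarkovSemigroup P)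
    (ρ : Measure (Config d q)) [IsProbabilityMeasure ρ] (f : C(Config d q, ℝ)) :
    Continuous fun t => ∫ η, f η ∂(evolve P ρ t) := by
  -- The bound is uniform in `s` by the semigroup property, so it gives left as well as right
  -- continuity.
  have key : ∀ ε > 0, ∀ᶠ t in 𝓝 (0 : ℝ≥0), ∀ s : ℝ≥0,
      |∫ η, f η ∂(evolve P ρ (s + t)) - ∫ η, f η ∂(evolve P ρ s)| ≤ ε := by
    intro ε hε
    filter_upwards [Metric.tendstoUniformly_iff.1 (hP.strongly_continuous f) ε hε] with t ht s
    have := hP.isProbabilityMeasure_evolve ρ s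
    rw [hP.evolve_add, hP.integral_evolve (evolve P ρ s), ← integral_sub
      (integrable_of_continuous _ (hP.feller t f)) (integrable_of_continuous _ f.continuous)]
    rw [← Real.norm_eq_abs]
    refine (norm_integral_le_of_norm_le_const (C := ε) (.of_forall fun η => ?_)).trans_eq
      (by simp)
    rw [← dist_eq_norm, dist_comm]
    exact (ht η).le
  refine continuous_iff_continuousAt.2 fun s => Metric.tendsto_nhds.2 fun ε hε => ?_
  -- With truncated subtraction this sum is `|t - s|`.
  have h0 : Tendsto (fun t : ℝ≥0 => (t - s) + (s - t)) (𝓝 s) (𝓝 0) := by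
    have : Continuous fun t : ℝ≥0 => (t - s) + (s - t) := by fun_prop
    simpa using this.tendsto s
  filter_upwards [h0.eventually (key (ε / 2) (half_pos hε))] with t ht
  rw [Real.dist_eq]
  refine lt_of_le_of_lt ?_ (half_lt_self hε)
  rcases le_total t s with h | h
  · have := ht t
    rwa [tsub_eq_zero_of_le h, zero_add, add_tsub_cancel_of_le h, abs_sub_comm] at this
  · have := ht s
    rwa [tsub_eq_zero_of_le h, add_zero, add_tsub_cancel_of_le h] at this

lemma IsSemigroupOf.hasDerivWithinAt_integral {c : Rates d q} (hP : IsSemigroupOf P c)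
    (ρ : Measure (Config d q)) [IsProbabilityMeasure ρ] {f : C(Config d q, ℝ)}
    (hf : f ∈ smoothFunctions d q) :
    HasDerivWithinAt (fun t : ℝ => ∫ η, f η ∂(evolve P ρ t.toNNReal))
      (∫ η, preGenerator c f η ∂ρ) (Set.Ici 0) 0 := by
  have hM := hP.isMarkovSemigroup
  have hgen := hP.generator f hf
  have hcont : ∀ t : ℝ≥0, Continuous fun η => (∫ ξ, f ξ ∂(P t η) - f η) / (t : ℝ) := fun t =>
    ((hM.feller t f).sub f.continuous).div_const _
  have hL : Continuous (preGenerator c f) := hgen.continuous (Frequently.of_forall hcont)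
  have key : Tendsto (fun t : ℝ≥0 => ∫ η, (∫ ξ, f ξ ∂(P t η) - f η) / (t : ℝ) ∂ρ) (𝓝[>] 0)
      (𝓝 (∫ η, preGenerator c f η ∂ρ)) := by
    refine Metric.tendsto_nhds.2 fun ε hε => ?_
    filter_upwards [Metric.tendstoUniformly_iff.1 hgen (ε / 2) (half_pos hε)] with t ht
    refine lt_of_le_of_lt ?_ (half_lt_self hε)
    rw [dist_eq_norm, ← integral_sub (integrable_of_continuous _ (hcont t))
      (integrable_of_continuous _ hL)]
    refine (norm_integral_le_of_norm_le_const (C := ε / 2) (.of_forall fun η => ?_)).trans_eq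
      (by simp)
    rw [← dist_eq_norm, dist_comm]
    exact (ht η).le
  rw [← hasDerivWithinAt_Ioi_iff_Ici, hasDerivWithinAt_iff_tendsto_slope' (by simp)]
  have hto : Tendsto Real.toNNReal (𝓝[>] 0) (𝓝[>] 0) := by
    refine tendsto_nhdsWithin_iff.2 ⟨?_, ?_⟩
    · have := (continuous_real_toNNReal.tendsto (0 : ℝ)).mono_left
        (nhdsWithin_le_nhds (s := Set.Ioi 0))
      simpa using this
    · filter_upwards [self_mem_nhdsWithin] with t ht
      simpa using ht
  refine (key.comp hto).congr' ?_
  filter_upwards [self_mem_nhdsWithin] with t ht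
  have ht' : (0 : ℝ) < t := ht
  simp only [Function.comp_apply, slope_def_field, sub_zero, Real.toNNReal_zero,
    Real.coe_toNNReal t ht'.le, integral_div]
  rw [hM.evolve_zero, hM.integral_evolve, integral_sub (integrable_of_continuous _ (hM.feller _ f))
    (integrable_of_continuous _ f.continuous)]

lemma IsSemigroupOf.integral_preGenerator_eq_zero {c : Rates d q} (hP : IsSemigroupOf P c)
    {μ : Measure (Config d q)} [IsProbabilityMeasure μ] (hμ : IsStationary P μ)
    {f : C(Config d q, ℝ)} (hf : f ∈ smoothFunctions d q) :
    ∫ η, preGenerator c f η ∂μ = 0 := by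
  have h := hP.hasDerivWithinAt_integral μ hf
  have h' : (fun t : ℝ => ∫ η, f η ∂(evolve P μ t.toNNReal)) = fun _ => ∫ η, f η ∂μ :=
    funext fun t => by rw [hμ]
  rw [h'] at h
  exact (uniqueDiffWithinAt_Ici (0 : ℝ)).eq_deriv _ h (hasDerivWithinAt_const _ _ _)

lemma relEntropy_toReal {Λ : Finset (Site d)} {μ : Measure (Config d q)}
    (hμ : ∀ ω : Λ → Fin q, μ (cyl Λ ω) ≠ 0) (ρ : Measure (Config d q)) :
    (relEntropy Λ ρ μ).toReal = ∑ ω : Λ → Fin q,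
      ρ.real (cyl Λ ω) * Real.log (ρ.real (cyl Λ ω) / μ.real (cyl Λ ω)) := by
  rw [relEntropy, if_pos, EReal.toReal_coe]
  intro s hs
  have : s = ∅ := by
    by_contra hne
    obtain ⟨ω, hω⟩ := Set.nonempty_iff_ne_empty.2 hne
    have h1 := measure_mono_null (Set.singleton_subset_iff.2 hω) hs
    rw [Measure.map_apply (Finset.measurable_restrict Λ) (measurableSet_singleton ω)] at h1
    exact hμ ω h1
  simp [this]

lemma IsSemigroupOf.entropyLoss_eq {c : Rates d q} (hP : IsSemigroupOf P c)
    (hc : ∀ x j, Continuous fun η => c x η j) {Λ : Finset (Site d)}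
    {μ ρ : Measure (Config d q)} [IsProbabilityMeasure μ] [IsProbabilityMeasure ρ]
    (hμ : ∀ ω : Λ → Fin q, 0 < μ.real (cyl Λ ω)) (hρ : ∀ ω : Λ → Fin q, 0 < ρ.real (cyl Λ ω)) :
    entropyLoss P Λ ρ μ = ∑ x : Λ, ∑ j, ∑ σ, (∫ η in cyl Λ σ, c x η j ∂ρ) *
      (Real.log (ρ.real (cyl Λ (Function.update σ x j)) /
          μ.real (cyl Λ (Function.update σ x j))) -
        Real.log (ρ.real (cyl Λ σ) / μ.real (cyl Λ σ))) := by
  have hM := hP.isMarkovSemigroup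
  -- This is the derivative of `p log (p / m)` in `p`. Its `+ 1` cancels in the differences taken by
  -- the generator.
  set F : (Λ → Fin q) → ℝ := fun ω =>
    Real.log (ρ.real (cyl Λ ω) / μ.real (cyl Λ ω)) + 1 with hF
  set b : (Λ → Fin q) → ℝ := fun ω =>
    ∫ η, preGenerator c (cylinderFun Λ (Pi.single ω 1)) η ∂ρ with hb
  have hmass : ∀ ω, HasDerivWithinAt (fun t : ℝ => (evolve P ρ t.toNNReal).real (cyl Λ ω))
      (b ω) (Set.Ici 0) 0 := by
    intro ω
    have h := hP.hasDerivWithinAt_integral ρ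
      (cylinderFun_mem_smoothFunctions Λ (Pi.single ω (1 : ℝ)))
    refine h.congr_of_mem (fun t _ => ?_) (by simp)
    have := hM.isProbabilityMeasure_evolve ρ t.toNNReal
    rw [real_cyl_eq_integral]
  have h0 : evolve P ρ (0 : ℝ).toNNReal = ρ := by rw [Real.toNNReal_zero, hM.evolve_zero]
  have hderiv : HasDerivWithinAt
      (fun t : ℝ => (relEntropy Λ (evolve P ρ t.toNNReal) μ).toReal)
      (∑ ω, b ω * F ω) (Set.Ici 0) 0 := by
    have hμ0 : ∀ ω : Λ → Fin q, μ (cyl Λ ω) ≠ 0 := fun ω h => (hμ ω).ne' (by simp [Measure.real, h])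
    rw [show (fun t : ℝ => (relEntropy Λ (evolve P ρ t.toNNReal) μ).toReal) = _ from
      funext fun t => relEntropy_toReal hμ0 _]
    refine HasDerivWithinAt.fun_sum fun ω _ => ?_
    have h1 := (hmass ω).mul (((hmass ω).div_const (μ.real (cyl Λ ω))).log
      (by rw [h0]; exact (div_pos (hρ ω) (hμ ω)).ne'))
    rw [h0] at h1
    have h2 : b ω * Real.log (ρ.real (cyl Λ ω) / μ.real (cyl Λ ω)) + ρ.real (cyl Λ ω) *
        (b ω / μ.real (cyl Λ ω) / (ρ.real (cyl Λ ω) / μ.real (cyl Λ ω))) = b ω * F ω := by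
      have := (hμ ω).ne'
      have := (hρ ω).ne'
      simp only [F]
      field_simp
    rw [h2] at h1
    exact h1
  rw [entropyLoss, hderiv.derivWithin (uniqueDiffWithinAt_Ici 0)]
  have hlin : ∑ ω, b ω * F ω = ∫ η, preGenerator c (cylinderFun Λ F) η ∂ρ := by
    simp only [hb, integral_preGenerator_cylinderFun hc]
    simp_rw [Finset.sum_mul]
    rw [Finset.sum_comm]
    refine Finset.sum_congr rfl fun x _ => ?_
    rw [Finset.sum_comm]
    refine Finset.sum_congr rfl fun j _ => ?_
    rw [Finset.sum_comm]
    refine Finset.sum_congr rfl fun σ _ => ?_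
    simp_rw [mul_assoc]
    rw [← Finset.mul_sum]
    simp [sub_mul, Pi.single_apply]
  rw [hlin, integral_preGenerator_cylinderFun hc]
  simp [hF]

end Evolution

/-! ### Dependence of the rates on distant sites -/

section Rates

lemma RateConditions.exists_sum_le {c : Rates d q} (hc : RateConditions c) :
    ∃ K : ℝ, 0 < K ∧ ∀ x η, ∑ j, c x η j ≤ K := by
  refine ⟨(⨆ x, ∑ j, ⨆ η, ‖c x η j‖ₑ).toReal + 1, by positivity, fun x η => ?_⟩
  have h1 : ∑ j, ‖c x η j‖ₑ ≤ ⨆ x, ∑ j, ⨆ η, ‖c x η j‖ₑ :=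
    (Finset.sum_le_sum fun j _ => le_iSup (fun η => ‖c x η j‖ₑ) η).trans
      (le_iSup (fun x => ∑ j, ⨆ η, ‖c x η j‖ₑ) x)
  have h2 := ENNReal.toReal_mono hc.bounded.ne h1
  rw [ENNReal.toReal_sum fun j _ => enorm_ne_top] at h2
  simp only [toReal_enorm] at h2
  have h3 : ∑ j, c x η j ≤ ∑ j, ‖c x η j‖ := Finset.sum_le_sum fun j _ => Real.le_norm_self _
  linarith

/-- The maximal influence of the state at `x + z` on the rates at `x`, for `z ≠ 0`. -/
def influence (c : Rates d q) (z : Site d) : ℝ :=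
  if z = 0 then 0 else (⨆ x, ∑ j, osc (x + z) (jumpRate c x j)).toReal

lemma influence_nonneg (c : Rates d q) (z : Site d) : 0 ≤ influence c z := by
  unfold influence
  split_ifs <;> positivity

lemma one_le_norm_of_ne_zero {z : Site d} (hz : z ≠ 0) : 1 ≤ ‖z‖ := by
  obtain ⟨i, hi⟩ := Function.ne_iff.1 hz
  refine le_trans ?_ (norm_le_pi_norm z i)
  rw [Int.norm_eq_abs]
  exact_mod_cast Int.one_le_abs hi

lemma RateConditions.summable_norm_mul_influence {c : Rates d q} (hc : RateConditions c) :
    Summable fun z => ‖z‖ * influence c z := by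
  refine (ENNReal.summable_toReal hc.shortRange.ne).congr fun z => ?_
  by_cases hz : z = 0
  · simp [hz]
  · simp [influence, hz, ENNReal.toReal_mul]

/-- The first moment dominates because `‖z‖ ≥ 1` off the origin. At the origin, where the moment
condition gives no control, `influence` is zero by definition. -/
lemma RateConditions.summable_influence {c : Rates d q} (hc : RateConditions c) :
    Summable (influence c) := by
  refine Summable.of_nonneg_of_le (influence_nonneg c) (fun z => ?_)
    hc.summable_norm_mul_influence
  by_cases hz : z = 0
  · simp [hz, influence]
  · exact le_mul_of_one_le_left (influence_nonneg c z) (one_le_norm_of_ne_zero hz)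

lemma RateConditions.sum_osc_le_influence {c : Rates d q} (hc : RateConditions c) (x : Site d)
    {z : Site d} (hz : z ≠ 0) :
    ∑ j, osc (x + z) (jumpRate c x j) ≤ ENNReal.ofReal (influence c z) := by
  have hfin : (⨆ x, ∑ j, osc (x + z) (jumpRate c x j)) ≠ ∞ := by
    intro h
    have h1 := ENNReal.ne_top_of_tsum_ne_top hc.shortRange.ne z
    rw [h, ENNReal.mul_top (by simpa using hz)] at h1
    exact h1 rfl
  rw [influence, if_neg hz, ENNReal.ofReal_toReal hfin]
  exact le_iSup (fun x => ∑ j, osc (x + z) (jumpRate c x j)) x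

lemma enorm_sub_le_osc (f : Config d q → ℝ) {y : Site d} {η ξ : Config d q}
    (h : ∀ z, z ≠ y → η z = ξ z) : ‖f η - f ξ‖ₑ ≤ osc y f :=
  le_iSup_of_le η (le_iSup_of_le ξ (le_iSup_of_le h le_rfl))

/-- Sites are switched from `η` to `ξ` one at a time; continuity passes from finite sets of sites to
the whole lattice. -/
lemma enorm_sub_le_tsum_osc {f : Config d q → ℝ} (hf : Continuous f) (Λ : Finset (Site d))
    {η ξ : Config d q} (h : ∀ x ∈ Λ, η x = ξ x) :
    ‖f η - f ξ‖ₑ ≤ ∑' y, if y ∈ Λ then 0 else osc y f := by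
  have hstep : ∀ s : Finset (Site d),
      ‖f η - f (s.piecewise ξ η)‖ₑ ≤ ∑ y ∈ s, if y ∈ Λ then 0 else osc y f := by
    intro s
    induction s using Finset.induction_on with
    | empty => simp
    | insert y s hy ih =>
      rw [Finset.sum_insert hy, add_comm]
      have h1 : f η - f ((insert y s).piecewise ξ η) = (f η - f (s.piecewise ξ η)) +
          (f (s.piecewise ξ η) - f ((insert y s).piecewise ξ η)) := by ring
      rw [h1]
      refine (enorm_add_le _ _).trans (add_le_add ih ?_)
      rw [Finset.piecewise_insert]
      split_ifs with hyΛ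
      · have : Function.update (s.piecewise ξ η) y (ξ y) = s.piecewise ξ η := by
          rw [Function.update_eq_self_iff, Finset.piecewise_eq_of_notMem _ _ _ hy, h y hyΛ]
        simp [this]
      · refine enorm_sub_le_osc f fun z hz => ?_
        rw [Function.update_of_ne hz]
  have hlim : Tendsto (fun s : Finset (Site d) => s.piecewise ξ η) atTop (𝓝 ξ) := by
    refine tendsto_pi_nhds.2 fun y => tendsto_const_nhds.congr' ?_
    filter_upwards [eventually_ge_atTop {y}] with s hs
    rw [Finset.piecewise_eq_of_mem _ _ _ (hs (Finset.mem_singleton_self y))]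
  have hlim' : Tendsto (fun s : Finset (Site d) => ‖f η - f (s.piecewise ξ η)‖ₑ) atTop
      (𝓝 ‖f η - f ξ‖ₑ) :=
    (tendsto_const_nhds.sub ((hf.tendsto ξ).comp hlim)).enorm
  exact le_of_tendsto hlim' (.of_forall fun s => (hstep s).trans (ENNReal.sum_le_tsum s))

lemma continuous_jumpRate {c : Rates d q} (hc : ∀ x j, Continuous fun η => c x η j)
    (x : Site d) (j : Fin q) : Continuous (jumpRate c x j) := by
  have : jumpRate c x j = fun η => (if η x = j then 0 else 1) * c x η j := by
    funext η
    simp [jumpRate]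
  rw [this]
  exact ((continuous_of_discreteTopology (f := fun i : Fin q => if i = j then (0 : ℝ) else 1)).comp
    (continuous_apply x)).mul (hc x j)

/-- A bound for the influence of the states outside `Λ` on the rates at `x`. -/
def outerInfluence (c : Rates d q) (Λ : Finset (Site d)) (x : Site d) : ℝ :=
  ∑' z, if x + z ∈ Λ then 0 else influence c z

lemma RateConditions.summable_outerInfluence {c : Rates d q} (hc : RateConditions c)
    (Λ : Finset (Site d)) (x : Site d) :
    Summable fun z => if x + z ∈ Λ then 0 else influence c z := by
  refine Summable.of_nonneg_of_le (fun z => ?_) (fun z => ?_) hc.summable_influence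
  · split_ifs
    exacts [le_rfl, influence_nonneg c z]
  · split_ifs
    exacts [influence_nonneg c z, le_rfl]

lemma outerInfluence_nonneg (c : Rates d q) (Λ : Finset (Site d)) (x : Site d) :
    0 ≤ outerInfluence c Λ x := by
  refine tsum_nonneg fun z => ?_
  split_ifs
  exacts [le_rfl, influence_nonneg c z]

lemma RateConditions.abs_sub_le_outerInfluence {c : Rates d q} (hc : RateConditions c)
    {Λ : Finset (Site d)} {x : Site d} (hx : x ∈ Λ) {j : Fin q} {η ξ : Config d q}
    (h : ∀ y ∈ Λ, η y = ξ y) (hj : η x ≠ j) :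
    |c x η j - c x ξ j| ≤ outerInfluence c Λ x := by
  have h1 := enorm_sub_le_tsum_osc (continuous_jumpRate hc.continuous x j) Λ h
  rw [← (Equiv.addLeft x).tsum_eq] at h1
  have h2 : ∑' z, (if Equiv.addLeft x z ∈ Λ then 0 else osc (Equiv.addLeft x z) (jumpRate c x j)) ≤
      ENNReal.ofReal (outerInfluence c Λ x) := by
    rw [outerInfluence, ENNReal.ofReal_tsum_of_nonneg (fun z => ?_)
      (hc.summable_outerInfluence Λ x)]
    · refine ENNReal.tsum_le_tsum fun z => ?_
      by_cases hz : x + z ∈ Λ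
      · rw [if_pos (show Equiv.addLeft x z ∈ Λ from hz), if_pos hz]
        exact zero_le
      · rw [if_neg (show Equiv.addLeft x z ∉ Λ from hz), if_neg hz]
        -- Since `x` lies in `Λ`, the excluded self-influence never enters.
        have hz0 : z ≠ 0 := by
          rintro rfl
          exact hz (by simpa using hx)
        exact (Finset.single_le_sum (f := fun j => osc (x + z) (jumpRate c x j))
          (fun _ _ => zero_le) (Finset.mem_univ j)).trans (hc.sum_osc_le_influence x hz0)
    · split_ifs
      exacts [le_rfl, influence_nonneg c z]
  have h3 := h1.trans h2
  rw [jumpRate, jumpRate, if_neg hj, if_neg (h x hx ▸ hj), Real.enorm_eq_ofReal_abs] at h3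
  exact (ENNReal.ofReal_le_ofReal_iff (outerInfluence_nonneg c Λ x)).1 h3

end Rates

/-! ### Rates averaged over cylinders -/

section ConditionalRates

/-- The rate of a change at `x` to the state `j`, averaged over the cylinder `[σ]`. -/
def condRate (c : Rates d q) (ρ : Measure (Config d q)) (Λ : Finset (Site d)) (x : Λ)
    (j : Fin q) (σ : Λ → Fin q) : ℝ :=
  (∫ η in cyl Λ σ, c x η j ∂ρ) / ρ.real (cyl Λ σ)

lemma abs_setAverage_sub_le {ρ : Measure (Config d q)} [IsFiniteMeasure ρ]
    {A : Set (Config d q)} (hρ : 0 < ρ.real A) {g : Config d q → ℝ}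
    (hg : Continuous g) {v ε : ℝ} (h : ∀ η ∈ A, |g η - v| ≤ ε) :
    |(∫ η in A, g η ∂ρ) / ρ.real A - v| ≤ ε := by
  have h1 : (∫ η in A, g η ∂ρ) / ρ.real A - v = (∫ η in A, (g η - v) ∂ρ) / ρ.real A := by
    rw [integral_sub (integrable_of_continuous ρ hg).integrableOn (integrable_const v)]
    simp only [integral_const, measureReal_restrict_apply_univ, smul_eq_mul]
    rw [sub_div, mul_div_cancel_left₀ _ hρ.ne']
  rw [h1, abs_div, abs_of_pos hρ, div_le_iff₀ hρ]
  exact norm_setIntegral_le_of_norm_le_const (f := fun η => g η - v) (measure_lt_top _ _) h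

lemma le_condRate {c : Rates d q} (hc : RateConditions c) {κ : ℝ}
    (hκ : ∀ x η j, κ ≤ c x η j) {ρ : Measure (Config d q)} [IsFiniteMeasure ρ]
    {Λ : Finset (Site d)} {σ : Λ → Fin q} (hρ : 0 < ρ.real (cyl Λ σ)) (x : Λ) (j : Fin q) :
    κ ≤ condRate c ρ Λ x j σ := by
  rw [condRate, le_div_iff₀ hρ]
  have h1 : ∫ _ in cyl Λ σ, κ ∂ρ ≤ ∫ η in cyl Λ σ, c x η j ∂ρ :=
    setIntegral_mono (integrable_const κ).integrableOn
      (integrable_of_continuous ρ (hc.continuous x j)).integrableOn fun η => hκ x η j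
  simpa [mul_comm] using h1

/-- Both are averages of one function over the same cylinder, on which its values differ by at most
the outer influence. -/
lemma abs_condRate_sub_le {c : Rates d q} (hc : RateConditions c)
    {ρ μ : Measure (Config d q)} [IsFiniteMeasure ρ] [IsFiniteMeasure μ]
    {Λ : Finset (Site d)} {σ : Λ → Fin q} (hρ : 0 < ρ.real (cyl Λ σ))
    (hμ : 0 < μ.real (cyl Λ σ)) {x : Λ} {j : Fin q} (hj : σ x ≠ j) :
    |condRate c ρ Λ x j σ - condRate c μ Λ x j σ| ≤ outerInfluence c Λ x := by
  refine abs_setAverage_sub_le hρ (hc.continuous x j) fun η hη => ?_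
  rw [abs_sub_comm]
  refine abs_setAverage_sub_le hμ (hc.continuous x j) fun ξ hξ => ?_
  have hη' : Λ.restrict η = σ := hη
  have hξ' : Λ.restrict ξ = σ := hξ
  refine hc.abs_sub_le_outerInfluence x.2 (fun y hy => ?_) ?_
  · exact congrFun (hξ'.trans hη'.symm) ⟨y, hy⟩
  · rw [← hξ'] at hj
    exact hj

end ConditionalRates

/-! ### Weights of the stationary product measure -/

section ProductMeasure

/-- `θ x j` are the weights of the one-site marginals of the product measure `μ`. -/
structure HasProductWeights (μ : Measure (Config d q)) (θ : Site d → Fin q → ℝ) : Prop where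
  le_one : ∀ x j, θ x j ≤ 1
  real_cyl : ∀ (Λ : Finset (Site d)) (ω : Λ → Fin q), μ.real (cyl Λ ω) = ∏ x : Λ, θ x (ω x)

lemma IsProductMeasure.exists_weights {μ : Measure (Config d q)} (hμ : IsProductMeasure μ) :
    ∃ θ, HasProductWeights μ θ := by
  obtain ⟨m, rfl⟩ := hμ
  refine ⟨fun x j => (m x : Measure (Fin q)).real {j},
    fun x j => measureReal_le_one, fun Λ ω => ?_⟩
  have h : Measure.infinitePi (fun x => (m x : Measure (Fin q))) (cyl Λ ω) =
      ∏ x : Λ, (m x : Measure (Fin q)) {ω x} := by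
    have h1 := Measure.infinitePi_map_restrict (μ := fun x => (m x : Measure (Fin q))) (I := Λ)
    have h2 := congrArg (fun M => M {ω}) h1
    rw [Measure.map_apply (Finset.measurable_restrict Λ) (measurableSet_singleton ω),
      Measure.pi_singleton] at h2
    exact h2
  rw [Measure.real, h, ENNReal.toReal_prod]
  rfl

lemma IsProductMeasure.isProbabilityMeasure {μ : Measure (Config d q)}
    (hμ : IsProductMeasure μ) : IsProbabilityMeasure μ := by
  obtain ⟨m, rfl⟩ := hμ
  infer_instance

variable {μ : Measure (Config d q)} {θ : Site d → Fin q → ℝ}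

lemma HasProductWeights.real_cyl_update (h : HasProductWeights μ θ) {Λ : Finset (Site d)}
    (x : Λ) (j : Fin q) (σ : Λ → Fin q) :
    μ.real (cyl Λ σ) * θ x j = μ.real (cyl Λ (Function.update σ x j)) * θ x (σ x) := by
  rw [h.real_cyl, h.real_cyl, ← Finset.mul_prod_erase _ _ (Finset.mem_univ x),
    ← Finset.mul_prod_erase _ (fun y : Λ => θ y (Function.update σ x j y)) (Finset.mem_univ x)]
  have : ∏ y ∈ Finset.univ.erase x, θ y (Function.update σ x j y) =
      ∏ y ∈ Finset.univ.erase x, θ y (σ y) :=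
    Finset.prod_congr rfl fun y hy => by rw [Function.update_of_ne (Finset.ne_of_mem_erase hy)]
  rw [this, Function.update_self]
  ring

/-- The one-site marginals of a stationary product measure are bounded away from zero. -/
lemma HasProductWeights.le_weight {P : ℝ≥0 → Kernel (Config d q) (Config d q)} {c : Rates d q}
    (hP : IsSemigroupOf P c) [IsProbabilityMeasure μ]
    (h : HasProductWeights μ θ) (hμ : IsStationary P μ) {κ K : ℝ}
    (hκ : ∀ x η j, κ ≤ c x η j) (hK0 : 0 < K) (hK : ∀ x η, ∑ j, c x η j ≤ K)
    (x : Site d) (j : Fin q) : κ / K ≤ θ x j := by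
  let x' : ({x} : Finset (Site d)) := ⟨x, Finset.mem_singleton_self x⟩
  let F : (({x} : Finset (Site d)) → Fin q) → ℝ := fun σ => if σ x' = j then 1 else 0
  have hθ : θ x j = ∫ η, cylinderFun {x} F η ∂μ := by
    have h1 := h.real_cyl {x} fun _ => j
    have h2 : ∏ y : ({x} : Finset (Site d)), θ y j = θ x j := by
      rw [Finset.prod_coe_sort {x} fun y => θ y j, Finset.prod_singleton]
    rw [← h2, ← h1, real_cyl_eq_integral]
    congr 1
    funext η
    simp only [cylinderFun, ContinuousMap.coe_mk, Pi.single_apply, F]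
    refine if_congr ⟨fun h => by rw [h], fun h => funext fun y => ?_⟩ rfl rfl
    have : y = x' := Subtype.ext (Finset.mem_singleton.1 y.2)
    rw [this, h]
  have hgen := hP.integral_preGenerator_eq_zero hμ (cylinderFun_mem_smoothFunctions {x} F)
  -- On the indicator of state `j` at `x`, the generator gives the rate to `j` minus the total rate
  -- times the indicator. Integrating against `μ` yields `κ - K * θ x j ≤ 0`.
  have hle : ∀ η, κ - K * cylinderFun {x} F η ≤ preGenerator c (cylinderFun {x} F) η := by
    intro η
    rw [preGenerator_cylinderFun]
    have h1 : ∀ y : ({x} : Finset (Site d)), y = x' := fun y =>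
      Subtype.ext (Finset.mem_singleton.1 y.2)
    rw [Fintype.sum_eq_single x' fun y hy => absurd (h1 y) hy]
    simp only [mul_sub, Finset.sum_sub_distrib]
    have h2 : ∑ i, c x η i * F (Function.update (({x} : Finset (Site d)).restrict η) x' i) =
        c x η j := by
      simp [F]
    have h3 : 0 ≤ F (({x} : Finset (Site d)).restrict η) := by
      simp only [F]; split_ifs <;> norm_num
    rw [h2, ← Finset.sum_mul]
    refine sub_le_sub (hκ x η j) ?_
    exact mul_le_mul_of_nonneg_right (hK x η) h3
  have hcont : Continuous (preGenerator c (cylinderFun {x} F)) :=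
    (hP.generator _ (cylinderFun_mem_smoothFunctions {x} F)).continuous
      (Frequently.of_forall fun t =>
        ((hP.isMarkovSemigroup.feller t _).sub (cylinderFun {x} F).continuous).div_const _)
  have hint : Integrable (fun η => K * cylinderFun {x} F η) μ :=
    integrable_of_continuous μ (continuous_const.mul (cylinderFun {x} F).continuous)
  have hmono := integral_mono ((integrable_const κ).sub hint) (integrable_of_continuous μ hcont) hle
  simp only [Pi.sub_apply] at hmono
  rw [hgen, integral_sub (integrable_const κ) hint, integral_const_mul, ← hθ] at hmono
  simp only [integral_const, probReal_univ, smul_eq_mul, one_mul] at hmono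
  rw [div_le_iff₀ hK0]
  linarith

end ProductMeasure

/-! ### Local energy and entropy loss -/

/-- The energy at the site `x` of the marginal of `ρ` on `Λ`. -/
def localEnergy (θ : Site d → Fin q → ℝ) (ρ : Measure (Config d q)) (Λ : Finset (Site d))
    (x : Λ) : ℝ :=
  siteEnergy (θ x) x fun σ : Λ → Fin q => ρ.real (cyl Λ σ)

lemma localEnergy_mono {θ : Site d → Fin q → ℝ} (hθ : ∀ x j, 0 < θ x j)
    (ρ : Measure (Config d q)) [IsFiniteMeasure ρ] {Λ Δ : Finset (Site d)} (h : Λ ⊆ Δ) (x : Λ) :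
    localEnergy θ ρ Λ x ≤ localEnergy θ ρ Δ (Set.inclusion h x) :=
  siteEnergy_marginal_le (hθ x) (Set.inclusion_injective h) x (fun _ => measureReal_nonneg)
    (real_cyl_marginal ρ h)

lemma IsSemigroupOf.sum_localEnergy_le {P : ℝ≥0 → Kernel (Config d q) (Config d q)}
    {c : Rates d q} (hP : IsSemigroupOf P c) (hc : RateConditions c)
    {μ ρ : Measure (Config d q)} [IsProbabilityMeasure μ] [IsProbabilityMeasure ρ]
    {θ : Site d → Fin q → ℝ} (hθ : HasProductWeights μ θ) (hμ : IsStationary P μ)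
    {κ δ : ℝ} (hκ0 : 0 ≤ κ) (hκ : ∀ x η j, κ ≤ c x η j) (hδ : 0 < δ) (hθδ : ∀ x j, δ ≤ θ x j)
    (Λ : Finset (Site d)) (hρ : ∀ ω : Λ → Fin q, 0 < ρ.real (cyl Λ ω)) {l : ℝ} (hl : 0 < l) :
    κ * ∑ x : Λ, localEnergy θ ρ Λ x ≤ -entropyLoss P Λ ρ μ +
      ∑ x : Λ, outerInfluence c Λ x * (l * localEnergy θ ρ Λ x + q * (1 + δ⁻¹) / (2 * l)) := by
  have hμpos : ∀ ω : Λ → Fin q, 0 < μ.real (cyl Λ ω) := fun ω => by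
    rw [hθ.real_cyl]
    exact Finset.prod_pos fun x _ => hδ.trans_le (hθδ _ _)
  have hmul : ∀ (τ : Measure (Config d q)) (x : Λ) (j : Fin q) (σ : Λ → Fin q),
      0 < τ.real (cyl Λ σ) →
        condRate c τ Λ x j σ * τ.real (cyl Λ σ) = ∫ η in cyl Λ σ, c x η j ∂τ :=
    fun τ x j σ hτ => div_mul_cancel₀ _ hτ.ne'
  -- Stationarity is tested on the local density of `ρ` with respect to `μ`.
  have hstat := hP.integral_preGenerator_eq_zero hμ (cylinderFun_mem_smoothFunctions Λ
    fun σ => ρ.real (cyl Λ σ) / μ.real (cyl Λ σ))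
  rw [integral_preGenerator_cylinderFun hc.continuous] at hstat
  have hmain := sum_siteEnergy_le (p := fun σ => ρ.real (cyl Λ σ))
    (m := fun σ => μ.real (cyl Λ σ)) (θ := fun x : Λ => θ x)
    (r := condRate c ρ Λ) (s := condRate c μ Λ) (ε := fun x => outerInfluence c Λ x)
    hρ hμpos (sum_real_cyl ρ Λ) hδ (fun x => hθδ x) (fun x => hθ.le_one x)
    (hθ.real_cyl_update) hκ0 (fun x j σ => le_condRate hc hκ (hρ σ) x j)
    (fun x => outerInfluence_nonneg c Λ x)
    (fun x j σ hj => abs_condRate_sub_le hc (hρ σ) (hμpos σ) hj)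
    (by simpa only [fun x j σ => hmul μ x j σ (hμpos σ)] using hstat) hl
  simp only [fun x j σ => hmul ρ x j σ (hρ σ), Fintype.card_fin] at hmain
  rw [hP.entropyLoss_eq hc.continuous hμpos hρ]
  exact hmain

/-! ### Boxes and boundary layers -/

section Boxes

/-- The sites of maximum norm less than `m`. -/
def box (d m : ℕ) : Finset (Site d) := Fintype.piFinset fun _ => Finset.Ioo (-(m : ℤ)) m

lemma mem_box {m : ℕ} {x : Site d} : x ∈ box d m ↔ ∀ i, (x i).natAbs < m := by
  simp only [box, Fintype.mem_piFinset, Finset.mem_Ioo]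
  exact forall_congr' fun i => by omega

lemma box_mono {m n : ℕ} (h : m ≤ n) : box d m ⊆ box d n := fun _ hx =>
  mem_box.2 fun i => (mem_box.1 hx i).trans_le h

lemma exists_subset_box (Λ : Finset (Site d)) : ∃ m, Λ ⊆ box d m := by
  refine ⟨∑ x ∈ Λ, ∑ i, (x i).natAbs + 1, fun x hx => mem_box.2 fun i => Nat.lt_succ_of_le ?_⟩
  exact (Finset.single_le_sum (f := fun i => (x i).natAbs) (fun _ _ => zero_le)
    (Finset.mem_univ i)).trans
      (Finset.single_le_sum (f := fun x : Site d => ∑ i, (x i).natAbs) (fun _ _ => zero_le) hx)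

lemma card_box (m : ℕ) : (box d m).card = (2 * m - 1) ^ d := by
  rw [box, Fintype.card_piFinset]
  simp only [Int.card_Ioo, Finset.prod_const, Finset.card_univ, Fintype.card_fin]
  congr 1
  omega

/-- The dimension matters here: a layer of thickness `k` has `O(m k)` sites, and this linear growth
in `m` leads to the divergent harmonic series. -/
lemma card_box_sub_le (hd : d = 1 ∨ d = 2) (m k : ℕ) :
    ((box d m).card : ℝ) - (box d (m - k)).card ≤ 8 * m * k := by
  rw [card_box, card_box]
  rcases Nat.eq_zero_or_pos m with rfl | hm
  · simp
  have hm' : (1 : ℝ) ≤ m := by exact_mod_cast hm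
  have hk : (0 : ℝ) ≤ k := Nat.cast_nonneg k
  have h1 : ((2 * m - 1 : ℕ) : ℝ) ≤ (2 * (m - k) - 1 : ℕ) + 2 * k := by
    exact_mod_cast (by omega : 2 * m - 1 ≤ 2 * (m - k) - 1 + 2 * k)
  have h2 : ((2 * m - 1 : ℕ) : ℝ) ≤ 2 * m := by exact_mod_cast (by omega : 2 * m - 1 ≤ 2 * m)
  have h3 : ((2 * (m - k) - 1 : ℕ) : ℝ) ≤ 2 * m := by
    exact_mod_cast (by omega : 2 * (m - k) - 1 ≤ 2 * m)
  have h4 : (0 : ℝ) ≤ (2 * m - 1 : ℕ) := Nat.cast_nonneg _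
  have h5 : (0 : ℝ) ≤ (2 * (m - k) - 1 : ℕ) := Nat.cast_nonneg _
  push_cast
  generalize ((2 * m - 1 : ℕ) : ℝ) = a at *
  generalize ((2 * (m - k) - 1 : ℕ) : ℝ) = b at *
  rcases hd with rfl | rfl
  · rw [pow_one, pow_one]
    nlinarith [mul_nonneg (sub_nonneg.2 hm') hk]
  · have h6 : (a - b) * (a + b) ≤ 2 * k * (a + b) :=
      mul_le_mul_of_nonneg_right (by linarith) (by linarith)
    have h7 : 2 * k * (a + b) ≤ 2 * k * (4 * m) :=
      mul_le_mul_of_nonneg_left (by linarith) (by linarith)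
    nlinarith

lemma notMem_box_sub {m : ℕ} {x z : Site d} (hx : x + z ∉ box d m) :
    x ∉ box d (m - ⌊‖z‖⌋₊) := by
  simp only [mem_box, not_forall, not_lt] at hx ⊢
  obtain ⟨i, hi⟩ := hx
  refine ⟨i, ?_⟩
  have h1 : (z i).natAbs ≤ ⌊‖z‖⌋₊ := by
    refine Nat.le_floor ?_
    refine le_trans (le_of_eq ?_) (norm_le_pi_norm z i)
    rw [Int.norm_eq_abs, Nat.cast_natAbs, Int.cast_abs]
  have h2 : (x i + z i).natAbs ≤ (x i).natAbs + (z i).natAbs := Int.natAbs_add_le _ _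
  rw [Pi.add_apply] at hi
  omega

lemma RateConditions.summable_floor_mul_influence {c : Rates d q} (hc : RateConditions c) :
    Summable fun z : Site d => (⌊‖z‖⌋₊ : ℝ) * influence c z :=
  Summable.of_nonneg_of_le (fun z => mul_nonneg (Nat.cast_nonneg _) (influence_nonneg c z))
    (fun z => mul_le_mul_of_nonneg_right (Nat.floor_le (norm_nonneg z)) (influence_nonneg c z))
    hc.summable_norm_mul_influence

/-- After exchanging the sums, a displacement `z` contributes only from sites that it carries out of
the box, and these lie in a boundary layer of thickness `‖z‖`. The weights `a` will be both the
energies and the constant one. -/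
lemma RateConditions.sum_outerInfluence_mul_le {c : Rates d q} (hc : RateConditions c) (m : ℕ)
    {a : Site d → ℝ} (ha : ∀ x, 0 ≤ a x) :
    ∑ x ∈ box d m, outerInfluence c (box d m) x * a x ≤
      ∑' z : Site d, influence c z *
        (∑ x ∈ box d m, a x - ∑ x ∈ box d (m - ⌊‖z‖⌋₊), a x) := by
  have hs : ∀ x ∈ box d m,
      Summable fun z => (if x + z ∈ box d m then 0 else influence c z) * a x := fun x _ =>
    (hc.summable_outerInfluence (box d m) x).mul_right _
  have hsub : ∀ z : Site d, 0 ≤ ∑ x ∈ box d (m - ⌊‖z‖⌋₊), a x := fun z =>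
    Finset.sum_nonneg fun x _ => ha x
  simp_rw [outerInfluence, ← tsum_mul_right]
  rw [← Summable.tsum_finsetSum hs]
  refine Summable.tsum_le_tsum (fun z => ?_) (summable_sum hs) ?_
  · rw [← Finset.sum_sdiff_eq_sub (box_mono (Nat.sub_le _ _)), Finset.mul_sum]
    calc _ = ∑ x ∈ box d m with x + z ∉ box d m, influence c z * a x := by
          rw [Finset.sum_filter]
          refine Finset.sum_congr rfl fun x _ => ?_
          by_cases h : x + z ∈ box d m <;> simp [h]
      _ ≤ _ := by
          refine Finset.sum_le_sum_of_subset_of_nonneg (fun x hx => ?_)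
            fun x _ _ => mul_nonneg (influence_nonneg c z) (ha x)
          rw [Finset.mem_filter] at hx
          exact Finset.mem_sdiff.2 ⟨hx.1, notMem_box_sub hx.2⟩
  · refine Summable.of_nonneg_of_le (fun z => mul_nonneg (influence_nonneg c z) ?_) (fun z => ?_)
      (hc.summable_influence.mul_right (∑ x ∈ box d m, a x))
    · rw [← Finset.sum_sdiff_eq_sub (box_mono (Nat.sub_le _ _))]
      exact Finset.sum_nonneg fun x _ => ha x
    · exact mul_le_mul_of_nonneg_left (by linarith [hsub z]) (influence_nonneg c z)

lemma RateConditions.sum_outerInfluence_le {c : Rates d q} (hc : RateConditions c)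
    (hd : d = 1 ∨ d = 2) (m : ℕ) :
    ∑ x ∈ box d m, outerInfluence c (box d m) x ≤
      8 * m * ∑' z : Site d, (⌊‖z‖⌋₊ : ℝ) * influence c z := by
  have h1 := hc.sum_outerInfluence_mul_le m (a := fun _ => 1) fun _ => zero_le_one
  simp only [mul_one, Finset.sum_const, nsmul_eq_mul] at h1
  refine h1.trans ?_
  rw [← tsum_mul_left]
  have hb : ∀ z : Site d, influence c z *
      (((box d m).card : ℝ) - (box d (m - ⌊‖z‖⌋₊)).card) ≤
        8 * m * ((⌊‖z‖⌋₊ : ℝ) * influence c z) := fun z => by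
    have := mul_le_mul_of_nonneg_left (card_box_sub_le hd m ⌊‖z‖⌋₊) (influence_nonneg c z)
    linarith
  have hs := hc.summable_floor_mul_influence.mul_left (8 * (m : ℝ))
  refine Summable.tsum_le_tsum hb (Summable.of_nonneg_of_le (fun z => ?_) hb hs) hs
  refine mul_nonneg (influence_nonneg c z) (sub_nonneg.2 ?_)
  exact_mod_cast Finset.card_le_card (box_mono (Nat.sub_le _ _))

end Boxes

/-! ### Energies integrated over time -/

section TimeAverage

variable {P : ℝ≥0 → Kernel (Config d q) (Config d q)} {c : Rates d q}
  {ν μ : Measure (Config d q)} {θ : Site d → Fin q → ℝ} {T : ℝ}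

lemma IsMarkovSemigroup.continuous_setIntegral_cyl (hP : IsMarkovSemigroup P)
    (ν : Measure (Config d q)) [IsProbabilityMeasure ν] (Λ : Finset (Site d)) (σ : Λ → Fin q)
    {g : Config d q → ℝ} (hg : Continuous g) :
    Continuous fun s : ℝ => ∫ η in cyl Λ σ, g η ∂(evolve P ν s.toNNReal) := by
  let f : C(Config d q, ℝ) := ⟨fun η => g η * (Pi.single σ 1 : (Λ → Fin q) → ℝ) (Λ.restrict η),
    hg.mul (continuous_comp_restrict Λ _)⟩
  refine ((hP.continuous_integral_evolve ν f).comp continuous_real_toNNReal).congr fun s => ?_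
  have := hP.isProbabilityMeasure_evolve ν s.toNNReal
  have h := integral_mul_comp_restrict (evolve P ν s.toNNReal) Λ hg
    (Pi.single σ 1 : (Λ → Fin q) → ℝ)
  simp only [Function.comp_apply, f, ContinuousMap.coe_mk, h]
  simp [Pi.single_apply]

lemma IsMarkovSemigroup.continuous_real_cyl (hP : IsMarkovSemigroup P)
    (ν : Measure (Config d q)) [IsProbabilityMeasure ν] (Λ : Finset (Site d)) (σ : Λ → Fin q) :
    Continuous fun s : ℝ => (evolve P ν s.toNNReal).real (cyl Λ σ) := by
  refine (hP.continuous_setIntegral_cyl ν Λ σ (g := fun _ => 1) continuous_const).congr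
    fun s => ?_
  simp

lemma IsMarkovSemigroup.continuous_localEnergy (hP : IsMarkovSemigroup P)
    (ν : Measure (Config d q)) [IsProbabilityMeasure ν] (θ : Site d → Fin q → ℝ)
    (Λ : Finset (Site d)) (x : Λ) :
    Continuous fun s : ℝ => localEnergy θ (evolve P ν s.toNNReal) Λ x := by
  have := hP.continuous_real_cyl ν Λ
  unfold localEnergy siteEnergy
  fun_prop

lemma IsSemigroupOf.continuous_entropyLoss (hP : IsSemigroupOf P c)
    (hc : ∀ x j, Continuous fun η => c x η j) [IsProbabilityMeasure μ] [IsProbabilityMeasure ν]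
    {Λ : Finset (Site d)} (hμ : ∀ ω : Λ → Fin q, 0 < μ.real (cyl Λ ω))
    (hν : ∀ (ω : Λ → Fin q) (s : ℝ≥0), 0 < (evolve P ν s).real (cyl Λ ω)) :
    Continuous fun s : ℝ => entropyLoss P Λ (evolve P ν s.toNNReal) μ := by
  have hM := hP.isMarkovSemigroup
  have heq : (fun s : ℝ => entropyLoss P Λ (evolve P ν s.toNNReal) μ) = _ := funext fun s =>
    have := hM.isProbabilityMeasure_evolve ν s.toNNReal
    hP.entropyLoss_eq hc hμ fun ω => hν ω s.toNNReal
  rw [heq]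
  refine continuous_finsetSum _ fun x _ => continuous_finsetSum _ fun j _ =>
    continuous_finsetSum _ fun σ _ => (hM.continuous_setIntegral_cyl ν Λ σ (hc x j)).mul ?_
  have hlog : ∀ ω : Λ → Fin q, Continuous fun s : ℝ =>
      Real.log ((evolve P ν s.toNNReal).real (cyl Λ ω) / μ.real (cyl Λ ω)) := fun ω =>
    ((hM.continuous_real_cyl ν Λ ω).div_const _).log fun s => (div_pos (hν ω _) (hμ ω)).ne'
  exact (hlog _).sub (hlog _)

/-- The energy at the site `x` of the marginal on `Λ`, integrated over the time interval
`[0, T]`, as a function on the whole lattice. -/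
def timeEnergy (P : ℝ≥0 → Kernel (Config d q) (Config d q)) (ν : Measure (Config d q))
    (θ : Site d → Fin q → ℝ) (T : ℝ) (Λ : Finset (Site d)) (x : Site d) : ℝ :=
  if h : x ∈ Λ then ∫ s in (0 : ℝ)..T, localEnergy θ (evolve P ν s.toNNReal) Λ ⟨x, h⟩ else 0

lemma timeEnergy_coe (Λ : Finset (Site d)) (x : Λ) : timeEnergy P ν θ T Λ x =
    ∫ s in (0 : ℝ)..T, localEnergy θ (evolve P ν s.toNNReal) Λ x := by
  simp [timeEnergy]

lemma timeEnergy_nonneg (hT : 0 ≤ T) (Λ : Finset (Site d)) (x : Site d) :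
    0 ≤ timeEnergy P ν θ T Λ x := by
  unfold timeEnergy
  split_ifs
  · exact intervalIntegral.integral_nonneg hT fun s _ => siteEnergy_nonneg _ _ _
  · exact le_rfl

lemma IsMarkovSemigroup.timeEnergy_mono (hP : IsMarkovSemigroup P) [IsProbabilityMeasure ν]
    (hθ : ∀ x j, 0 < θ x j) (hT : 0 ≤ T) {Λ Δ : Finset (Site d)} (h : Λ ⊆ Δ) (x : Site d) :
    timeEnergy P ν θ T Λ x ≤ timeEnergy P ν θ T Δ x := by
  by_cases hx : x ∈ Λ
  · rw [timeEnergy_coe Λ ⟨x, hx⟩, timeEnergy_coe Δ ⟨x, h hx⟩]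
    refine intervalIntegral.integral_mono_on hT
      ((hP.continuous_localEnergy ν θ Λ _).intervalIntegrable _ _)
      ((hP.continuous_localEnergy ν θ Δ _).intervalIntegrable _ _) fun s _ => ?_
    have := hP.isProbabilityMeasure_evolve ν s.toNNReal
    exact localEnergy_mono hθ _ h ⟨x, hx⟩
  · rw [timeEnergy, dif_neg hx]
    exact timeEnergy_nonneg hT _ _

/-- The parameter `l` is held constant in time while integrating, since only the time integral of
the entropy loss is known to vanish; it is optimised afterwards. -/
lemma IsSemigroupOf.sq_sum_timeEnergy_le (hP : IsSemigroupOf P c) (hc : RateConditions c)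
    [IsProbabilityMeasure μ] [IsProbabilityMeasure ν]
    (hθ : HasProductWeights μ θ) (hμ : IsStationary P μ)
    {κ δ : ℝ} (hκ0 : 0 ≤ κ) (hκ : ∀ x η j, κ ≤ c x η j) (hδ : 0 < δ) (hθδ : ∀ x j, δ ≤ θ x j)
    {Λ : Finset (Site d)} (hν : ∀ (ω : Λ → Fin q) (s : ℝ≥0), 0 < (evolve P ν s).real (cyl Λ ω))
    (hT : 0 ≤ T) (hloss : ∫ s in (0 : ℝ)..T, entropyLoss P Λ (evolve P ν s.toNNReal) μ = 0) :
    (κ * ∑ x ∈ Λ, timeEnergy P ν θ T Λ x) ^ 2 ≤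
      4 * (∑ x ∈ Λ, outerInfluence c Λ x * timeEnergy P ν θ T Λ x) *
        (T * q * (1 + δ⁻¹) / 2 * ∑ x ∈ Λ, outerInfluence c Λ x) := by
  have hM := hP.isMarkovSemigroup
  have hμpos : ∀ ω : Λ → Fin q, 0 < μ.real (cyl Λ ω) := fun ω => by
    rw [hθ.real_cyl]
    exact Finset.prod_pos fun x _ => hδ.trans_le (hθδ _ _)
  refine sq_le_of_forall_le_mul_add_div
    (mul_nonneg hκ0 (Finset.sum_nonneg fun x _ => timeEnergy_nonneg hT _ _))
    (Finset.sum_nonneg fun x _ => mul_nonneg (outerInfluence_nonneg _ _ _)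
      (timeEnergy_nonneg hT _ _))
    (mul_nonneg (by positivity) (Finset.sum_nonneg fun x _ => outerInfluence_nonneg _ _ _))
    fun l hl => ?_
  have hE := hM.continuous_localEnergy ν θ Λ
  have hG := hP.continuous_entropyLoss hc.continuous hμpos hν
  have hR : ∀ x : Λ, Continuous fun s : ℝ => outerInfluence c Λ x *
      (l * localEnergy θ (evolve P ν s.toNNReal) Λ x + q * (1 + δ⁻¹) / (2 * l)) :=
    fun x => continuous_const.mul ((continuous_const.mul (hE x)).add continuous_const)
  have hRsum := (continuous_finsetSum Finset.univ fun x _ => hR x).intervalIntegrable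
    (μ := volume) 0 T
  have h1 := intervalIntegral.integral_mono_on hT
    (f := fun s : ℝ => κ * ∑ x : Λ, localEnergy θ (evolve P ν s.toNNReal) Λ x)
    (g := fun s : ℝ => -entropyLoss P Λ (evolve P ν s.toNNReal) μ +
      ∑ x : Λ, outerInfluence c Λ x * (l * localEnergy θ (evolve P ν s.toNNReal) Λ x +
        q * (1 + δ⁻¹) / (2 * l)))
    (Continuous.intervalIntegrable
      (continuous_const.mul (continuous_finsetSum _ fun x _ => hE x)) _ _)
    ((hG.neg.intervalIntegrable _ _).add hRsum)
    fun s _ => by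
      have := hM.isProbabilityMeasure_evolve ν s.toNNReal
      exact hP.sum_localEnergy_le hc hθ hμ hκ0 hκ hδ hθδ Λ (fun ω => hν ω _) hl
  rw [intervalIntegral.integral_const_mul, intervalIntegral.integral_finsetSum
    fun x _ => (hE x).intervalIntegrable _ _, intervalIntegral.integral_add
    (f := fun s : ℝ => -entropyLoss P Λ (evolve P ν s.toNNReal) μ)
    (hG.neg.intervalIntegrable _ _) hRsum,
    intervalIntegral.integral_neg, hloss, neg_zero, zero_add,
    intervalIntegral.integral_finsetSum fun x _ => (hR x).intervalIntegrable _ _] at h1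
  rw [← Finset.sum_coe_sort Λ, ← Finset.sum_coe_sort Λ, ← Finset.sum_coe_sort Λ]
  simp_rw [timeEnergy_coe]
  refine h1.trans (le_of_eq ?_)
  rw [Finset.mul_sum, Finset.mul_sum, Finset.sum_div, ← Finset.sum_add_distrib]
  refine Finset.sum_congr rfl fun x _ => ?_
  rw [intervalIntegral.integral_const_mul, intervalIntegral.integral_add
    (((hE x).const_mul _).intervalIntegrable _ _) (by simp), intervalIntegral.integral_const_mul,
    intervalIntegral.integral_const, sub_zero, smul_eq_mul]
  field_simp

end TimeAverage

/-! ### Cylinder probabilities determine the measure -/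

section Uniqueness

variable {μ ν : Measure (Config d q)}

lemma eq_of_forall_real_cyl_eq [IsProbabilityMeasure μ] [IsProbabilityMeasure ν]
    (h : ∀ (Λ : Finset (Site d)) (ω : Λ → Fin q), ν.real (cyl Λ ω) = μ.real (cyl Λ ω)) :
    ν = μ := by
  have hν : IsProjectiveLimit ν fun Λ : Finset (Site d) => μ.map Λ.restrict := by
    intro Λ
    refine Measure.ext_of_singleton fun ω => ?_
    rw [Measure.map_apply (Finset.measurable_restrict Λ) (measurableSet_singleton ω),
      Measure.map_apply (Finset.measurable_restrict Λ) (measurableSet_singleton ω)]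
    exact (measureReal_eq_measureReal_iff).1 (h Λ ω)
  have : ∀ Λ : Finset (Site d), IsFiniteMeasure (μ.map Λ.restrict) := fun Λ => inferInstance
  exact hν.unique fun Λ => rfl

end Uniqueness

end IPS

end

/-! ### The entropy loss principle -/

theorem mainTheorem3 (d q : ℕ) (hd : d = 1 ∨ d = 2)
    (c : IPS.Rates d q) (hc : IPS.RateConditions c)
    (P : ℝ≥0 → Kernel (IPS.Config d q) (IPS.Config d q)) (hP : IPS.IsSemigroupOf P c)
    (μ : Measure (IPS.Config d q)) (hμ : IPS.IsProductMeasure μ) (hμP : IPS.IsStationary P μ)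
    (ν : Measure (IPS.Config d q)) [IsProbabilityMeasure ν]
    (hM1 : ∀ (Λ : Finset (IPS.Site d)) (ω : Λ → Fin q) (s : ℝ≥0),
      0 < IPS.evolve P ν s (IPS.cyl Λ ω))
    (T : ℝ) (hT : 0 < T)
    (hM2 : ∀ Λ : Finset (IPS.Site d),
      ∫ s in (0 : ℝ)..T, IPS.entropyLoss P Λ (IPS.evolve P ν s.toNNReal) μ = 0) :
    ν = μ := by
  open IPS in
  have hM := hP.isMarkovSemigroup
  have := hμ.isProbabilityMeasure
  obtain ⟨θ, hθ⟩ := hμ.exists_weights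
  obtain ⟨K, hK0, hK⟩ := hc.exists_sum_le
  obtain ⟨κ, hκ0, hκ⟩ := hc.nondegenerate
  have hδ : 0 < κ / K := div_pos hκ0 hK0
  have hθδ : ∀ x j, κ / K ≤ θ x j := hθ.le_weight hP hμP hκ hK0 hK
  have hθ0 : ∀ x j, 0 < θ x j := fun x j => hδ.trans_le (hθδ x j)
  have hν : ∀ (Λ : Finset (Site d)) (ω : Λ → Fin q) (s : ℝ≥0),
      0 < (evolve P ν s).real (cyl Λ ω) := fun Λ ω s => by
    have := hM.isProbabilityMeasure_evolve ν s
    exact ENNReal.toReal_pos (hM1 Λ ω s).ne' (measure_ne_top _ _)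
  let A : ℕ → Site d → ℝ := fun m => timeEnergy P ν θ T (box d m)
  have hA0 : ∀ m x, 0 ≤ A m x := fun m => timeEnergy_nonneg hT.le _
  let S : ℕ → ℝ := fun m => ∑ x ∈ box d m, A m x
  have hSsub : ∀ {m n : ℕ}, m ≤ n → S m ≤ ∑ x ∈ box d m, A n x := fun h =>
    Finset.sum_le_sum fun x _ => hM.timeEnergy_mono hθ0 hT.le (box_mono h) x
  have hS : Monotone S := fun m n h => (hSsub h).trans
    (Finset.sum_le_sum_of_subset_of_nonneg (box_mono h) fun x _ _ => hA0 n x)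
  -- The box of radius zero is empty because its defining inequality is strict and `d` is positive.
  have hS0 : S 0 = 0 := by
    have : box d 0 = ∅ := by
      refine Finset.card_eq_zero.1 ?_
      rw [card_box]
      rcases hd with rfl | rfl <;> rfl
    simp [S, this]
  set W := ∑' z : Site d, (⌊‖z‖⌋₊ : ℝ) * influence c z with hW
  have hW0 : 0 ≤ W := tsum_nonneg fun z => mul_nonneg (Nat.cast_nonneg _) (influence_nonneg c z)
  set C₀ := T * q * (1 + (κ / K)⁻¹) / 2 with hC₀
  have hC₀0 : 0 ≤ C₀ := by positivity
  have hsum : ∀ m : ℕ, Summable fun z : Site d =>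
      influence c z * (S m - S (m - ⌊‖z‖⌋₊)) := fun m =>
    Summable.of_nonneg_of_le (fun z => mul_nonneg (influence_nonneg c z)
      (sub_nonneg.2 (hS (Nat.sub_le _ _)))) (fun z => mul_le_mul_of_nonneg_left
        (sub_le_self _ (hS0 ▸ hS (Nat.zero_le _))) (influence_nonneg c z))
      (hc.summable_influence.mul_right (S m))
  have hSzero : ∀ m, S m = 0 := by
    -- The factor `32` is `4` from the optimisation times `8` from the boundary count.
    refine eq_zero_of_sq_le_tsum hS hS0 (influence_nonneg c) hc.summable_influence
      hc.summable_floor_mul_influence (C := 32 * C₀ * W / κ ^ 2) (by positivity) fun m => ?_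
    have h1 := hP.sq_sum_timeEnergy_le hc hθ hμP hκ0.le hκ hδ hθδ (hν (box d m)) hT.le
      (hM2 (box d m))
    have h2 : ∑ x ∈ box d m, outerInfluence c (box d m) x * A m x ≤
        ∑' z : Site d, influence c z * (S m - S (m - ⌊‖z‖⌋₊)) := by
      refine (hc.sum_outerInfluence_mul_le m (hA0 m)).trans ?_
      -- Energies in the inner box are computed from the larger marginal; replacing them by the
      -- smaller `S (m - ⌊‖z‖⌋₊)` closes the recursion in `S`.
      have hle : ∀ z : Site d, influence c z * (∑ x ∈ box d m, A m x -
          ∑ x ∈ box d (m - ⌊‖z‖⌋₊), A m x) ≤ influence c z * (S m - S (m - ⌊‖z‖⌋₊)) := fun z =>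
        mul_le_mul_of_nonneg_left (sub_le_sub_left (hSsub (Nat.sub_le _ _)) _)
          (influence_nonneg c z)
      refine Summable.tsum_le_tsum hle (Summable.of_nonneg_of_le (fun z => ?_) hle (hsum m))
        (hsum m)
      rw [← Finset.sum_sdiff_eq_sub (box_mono (Nat.sub_le _ _))]
      exact mul_nonneg (influence_nonneg c z) (Finset.sum_nonneg fun x _ => hA0 m x)
    have h3 := mul_le_mul_of_nonneg_left (hc.sum_outerInfluence_le hd m) hC₀0
    have h4 : (κ * S m) ^ 2 ≤ 4 * (∑' z : Site d, influence c z * (S m - S (m - ⌊‖z‖⌋₊))) *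
        (C₀ * (8 * m * W)) := by
      refine h1.trans (mul_le_mul (mul_le_mul_of_nonneg_left h2 (by norm_num)) h3
        (mul_nonneg hC₀0 (Finset.sum_nonneg fun x _ => outerInfluence_nonneg _ _ _))
        (mul_nonneg (by norm_num) (tsum_nonneg fun z => mul_nonneg (influence_nonneg c z)
          (sub_nonneg.2 (hS (Nat.sub_le _ _))))))
    rw [mul_pow] at h4
    rw [div_mul_eq_mul_div, div_mul_eq_mul_div, le_div_iff₀ (by positivity)]
    linarith
  have hE0 : ∀ (Λ : Finset (Site d)) (x : Λ), localEnergy θ ν Λ x = 0 := by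
    intro Λ x
    obtain ⟨m, hm⟩ := exists_subset_box Λ
    refine le_antisymm ?_ (siteEnergy_nonneg _ _ _)
    refine (localEnergy_mono hθ0 ν hm x).trans ?_
    have h1 := (Finset.sum_eq_zero_iff_of_nonneg fun x _ => hA0 m x).1 (hSzero m) x (hm x.2)
    simp only [A] at h1
    rw [timeEnergy_coe (box d m) ⟨x, hm x.2⟩] at h1
    -- A positive energy at time zero would, by continuity, make the time integral positive.
    by_contra! hpos
    refine absurd h1 (intervalIntegral.integral_pos hT
      (hM.continuous_localEnergy ν θ (box d m) _).continuousOn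
      (fun s _ => siteEnergy_nonneg _ _ _) ⟨0, ⟨le_rfl, hT.le⟩, ?_⟩).ne'
    rw [Real.toNNReal_zero, hM.evolve_zero]
    exact hpos
  refine eq_of_forall_real_cyl_eq fun Λ ω => ?_
  have hν0 : ∀ ω : Λ → Fin q, 0 < ν.real (cyl Λ ω) := fun ω => by
    have := hν Λ ω 0
    rwa [hM.evolve_zero] at this
  have hμ0 : ∀ ω : Λ → Fin q, 0 < μ.real (cyl Λ ω) := fun ω => by
    rw [hθ.real_cyl]
    exact Finset.prod_pos fun x _ => hθ0 _ _
  exact congrFun (eq_of_siteEnergy_eq_zero (p := fun σ => ν.real (cyl Λ σ))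
    (m := fun σ => μ.real (cyl Λ σ)) (θ := fun x : Λ => θ x) hν0 hμ0 (sum_real_cyl ν Λ)
    (sum_real_cyl μ Λ) (fun x => hθ0 x) hθ.real_cyl_update (hE0 Λ)) ω
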